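/- Let $M,L\ge 1$ and $w\in\{3,4\}$ be integers with $L\ge M\ge w$, let $\mathcal M=\{0,\dots,M-1\}$ be the set of channels, and describe a zero-one $M\times L$ array by the set $S\subseteq\mathcal M\times\mathbb Z_L$ of positions of its ones. An MC-CAC$(M,L,w)$ is a set $\mathcal C$ of subsets of $\mathcal M\times\mathbb Z_L$, called codewords, each of cardinality $w$, such that $|\{(i,j)\in S:(i,j+\tau)\in S'\}|\le 1$ for all distinct $S,S'\in\mathcal C$ and all $\tau\in\mathbb Z_L$. It is *optimal* if $|\mathcal C|=A(M,L,w)$, the largest cardinality of an MC-CAC$(M,L,w)$. A CAC$(L,w)$ is an MC-CAC$(1,L,w)$, its codewords being written as subsets of $\mathbb Z_L$. It is *equi-difference* if each codeword is an arithmetic progression $\{s,s+a,\dots,s+(w-1)a\}$ in $\mathbb Z_L$, and it is then *tight* if each nonzero $\delta\in\mathbb Z_L$ is the difference of two elements of some codeword. A GBRD (generalized Bhaskar Rao design) signed over $\mathbb Z_L$ is an $M\times b$ array $X$ with $b=LM(M-1)/(w(w-1))$, each of whose entries is either empty or an element of $\mathbb Z_L$, with exactly $w$ nonempty entries in each column,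 and such that for any two distinct rows $i_1,i_2$ there are exactly $L$ columns $j$ in which $X(i_1,j)$ and $X(i_2,j)$ are both nonempty, and the differences $X(i_1,j)-X(i_2,j)$ over these columns are all the elements of $\mathbb Z_L$, each occurring exactly once. **Theorem.** Let $\mathcal C_0$ be an equi-difference tight CAC$(L,w)$ and let $X$ be an $M\times b$ GBRD over $\mathbb Z_L$ with $w$ nonempty entries in each column. Then the set $\mathcal C$ consisting of the codewords $\{(i,X(i,j)): X(i,j)\text{ nonempty}\}$, one for each column $j$ of $X$, and of the codewords $\{i\}\times T$, for $i\in\mathcal M$ and $T\in\mathcal C_0$, is an optimal MC-CAC$(M,L,w)$. Moreover, writing $\mathbf 1_{d\mid L}=1$ if $d$ divides $L$ and $0$ otherwise: - if $w=3$, then $|\mathcal C|=\left\lfloor \frac{M}{12}\left(2ML+L-3+3\cdot\mathbf 1_{2\mid L}+6\cdot\mathbf 1_{3\mid L}\right)\right\rfloor$; - if $w=4$ and $L\ne 6$, then $|\mathcal C|=\left\lfloor \frac{M}{12}\left(ML+L-2+2J\right)\right\rfloor$, where $J=\mathbf 1_{2\mid L}+2\cdot\mathbf 1_{3\mid L}+2\cdot\mathbf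 1_{4\mid L}+2\cdot\mathbf 1_{5\mid L}$. -/

import Mathlib

/-- A zero-one `M × L` array is recorded by the set of positions of its ones, a scheduling pattern.
`crossCorrelation S S' τ` is `∑ i, ∑ j, X (i, j) * X' (i, j + τ)` for the arrays `X`, `X'` with
supports `S`, `S'`. -/
def crossCorrelation {M L : ℕ} (S S' : Finset (Fin M × ZMod L)) (τ : ZMod L) : ℕ :=
  (S.filter fun p => (p.1, p.2 + τ) ∈ S').card

/-- `C` is an MC-CAC`(M, L, w)`: every codeword has weight `w`, and two distinct codewords have at
most one overlapping one, whatever their relative time offset. -/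
def IsMCCAC (M L w : ℕ) (C : Finset (Finset (Fin M × ZMod L))) : Prop :=
  (∀ S ∈ C, S.card = w) ∧
    ∀ S ∈ C, ∀ S' ∈ C, S ≠ S' → ∀ τ : ZMod L, crossCorrelation S S' τ ≤ 1

/-- `C` is an optimal MC-CAC`(M, L, w)`: its size is the largest cardinality `A(M, L, w)` among all
MC-CAC`(M, L, w)`s. -/
def IsOptimalMCCAC (M L w : ℕ) (C : Finset (Finset (Fin M × ZMod L))) : Prop :=
  IsMCCAC M L w C ∧
    IsGreatest {n : ℕ | ∃ C' : Finset (Finset (Fin M × ZMod L)), IsMCCAC M L w C' ∧ C'.card = n}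
      C.card

/-- The single-channel pattern `T` placed in channel `i`. -/
def onChannel {M L : ℕ} (i : Fin M) (T : Finset (ZMod L)) : Finset (Fin M × ZMod L) :=
  {i} ×ˢ T

/-- A CAC`(L, w)` is an MC-CAC with one channel; its codewords are written as sets of time
indices. -/
def IsCAC (L w : ℕ) (C : Finset (Finset (ZMod L))) : Prop :=
  IsMCCAC 1 L w (C.image (onChannel 0))

/-- Every codeword is an arithmetic progression `s, s + a, …, s + (w - 1) a` in `ZMod L`. -/
def IsEquiDifference (L w : ℕ) (C : Finset (Finset (ZMod L))) : Prop :=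
  ∀ T ∈ C, ∃ s a : ZMod L, T = (Finset.range w).image fun k : ℕ => s + (k : ZMod L) * a

/-- Every nonzero `δ` is a difference of two time indices of some codeword. -/
def IsTight (L : ℕ) (C : Finset (Finset (ZMod L))) : Prop :=
  ∀ δ : ZMod L, δ ≠ 0 → ∃ T ∈ C, ∃ t₁ ∈ T, ∃ t₂ ∈ T, t₁ - t₂ = δ

/-- `X` is an `M × b` generalized Bhaskar Rao design signed over `ZMod L` (`none` is the empty
entry) with `w` nonempty entries in each column: here `b = L M (M - 1) / (w (w - 1))`, and for any
two distinct rows the differences over the columns in which both entries are nonempty run through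
each element of `ZMod L` exactly once. -/
def IsGBRD (M L w b : ℕ) (X : Fin M → Fin b → Option (ZMod L)) : Prop :=
  b * (w * (w - 1)) = L * (M * (M - 1)) ∧
    (∀ j : Fin b, (Finset.univ.filter fun i : Fin M => (X i j).isSome).card = w) ∧
    ∀ i₁ i₂ : Fin M, i₁ ≠ i₂ → ∀ δ : ZMod L,
      ∃! j : Fin b, ∃ x y : ZMod L, X i₁ j = some x ∧ X i₂ j = some y ∧ x - y = δ

/-- Column `j` of the array `X` as a scheduling pattern: `{(i, X i j) : X i j nonempty}`. -/
def columnPattern {M L b : ℕ} [NeZero L] (X : Fin M → Fin b → Option (ZMod L)) (j : Fin b) :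
    Finset (Fin M × ZMod L) :=
  Finset.univ.filter fun p => X p.1 j = some p.2

/-- The columns of `X` together with a copy of `C₀` in each of the `M` channels. -/
def combinedCode {M L b : ℕ} [NeZero L] (X : Fin M → Fin b → Option (ZMod L))
    (C₀ : Finset (Finset (ZMod L))) : Finset (Finset (Fin M × ZMod L)) :=
  Finset.univ.image (columnPattern X) ∪
    Finset.univ.biUnion fun i : Fin M => C₀.image (onChannel i)

/-- The upper bound on the size of an MC-CAC`(M, L, 3)`. -/
def sizeBound3 (M L : ℕ) : ℤ :=
  ⌊(M : ℚ) / 12 * (2 * M * L + L - 3 + (if 2 ∣ L then 3 else 0) + (if 3 ∣ L then 6 else 0))⌋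

/-- The upper bound on the size of an MC-CAC`(M, L, 4)`. -/
def sizeBound4 (M L : ℕ) : ℤ :=
  ⌊(M : ℚ) / 12 * (M * L + L - 2 + 2 * ((if 2 ∣ L then 1 else 0) + (if 3 ∣ L then 2 else 0) +
    (if 4 ∣ L then 2 else 0) + (if 5 ∣ L then 2 else 0)))⌋

/-!
The proof is a weighted count of differences. In an MC-CAC no difference, between two ones in
channels `i` and `j`, occurs in two distinct codewords (`IsMCCAC.eq_of_sub_eq`). Give every
difference between two distinct channels a weight `α`, and every nonzero difference `δ` inside a
channel a weight `β δ`. If each `w`-subset has weight at least `N`, then the size of any MC-CAC is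
at most `1 / N` times the total weight of all differences (`IsMCCAC.card_mul_le`). That every
`w`-subset is heavy enough is reduced by `le_weight_of_profile` to statements about subsets of
`ZMod L` with at most `w` elements.

For `w = 3` take `N = 12`, `α = 2` and `β = 3`, raised to `6` on elements of order two or three. For
`w = 4` and `3 ∤ L` take `N = 12`, `α = 1` and `β = 2`, raised to `8` on the involution and to `3` on
elements of order five. The raised weights compensate for coincidences among the differences of a
codeword, which are caused by elements of small order; a codeword inside one channel still weighs at
least `12`.

In the combined code every column has weight exactly `12`, and the columns use up all differences
between distinct channels. The codewords of the tight code use up all differences inside a channel,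
so optimality amounts to each of them having weight exactly `12` as well. This requires excluding
steps for which an element of small order occurs as a proper multiple of the step, which is where
equi-difference and tightness interact. For `w = 3` a tight code with `L` even has `L = 4`
(`IsStepPartition.four_eq_zero`). For `w = 4`, `3 ∣ L` forces `L = 6`
(`IsStepPartition.six_eq_zero`, `IsStepPartition.eq_zero_of_three_mul`), no step has order ten
(`IsStepPartition.ten_mul_ne_zero`), and `2 ∣ L` forces `4 ∣ L`
(`IsStepPartition.exists_order_four`). The exact sizes then follow by counting elements of order
two, three and five.

The case `w = 4`, `L = 6` uses separate weights, for which the bound exceeds the size of the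
combined code by `M / 12 < 1`, as `M ≤ L`.
-/

open Finset
open scoped Pointwise

/-! ### Differences of codewords -/

/-- The nonzero differences of two elements of `A`. -/
def innerDiffs {R : Type*} [AddGroup R] [DecidableEq R] (A : Finset R) : Finset R :=
  A.offDiag.image fun p => p.1 - p.2

lemma sub_mem_innerDiffs {R : Type*} [AddGroup R] [DecidableEq R] {A : Finset R} {x y : R}
    (hx : x ∈ A) (hy : y ∈ A) (h : x ≠ y) : x - y ∈ innerDiffs A :=
  mem_image.2 ⟨(x, y), mem_offDiag.2 ⟨hx, hy, h⟩, rfl⟩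

lemma mem_innerDiffs {R : Type*} [AddGroup R] [DecidableEq R] {A : Finset R} {δ : R} :
    δ ∈ innerDiffs A ↔ ∃ x ∈ A, ∃ y ∈ A, x ≠ y ∧ x - y = δ := by
  simp only [innerDiffs, mem_image, mem_offDiag, Prod.exists]
  grind

lemma zero_notMem_innerDiffs {R : Type*} [AddGroup R] [DecidableEq R] (A : Finset R) :
    (0 : R) ∉ innerDiffs A := by
  rw [mem_innerDiffs]
  rintro ⟨x, -, y, -, h, h'⟩
  exact h (sub_eq_zero.1 h')

lemma neg_mem_innerDiffs {R : Type*} [AddGroup R] [DecidableEq R] {A : Finset R} {δ : R}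
    (h : δ ∈ innerDiffs A) : -δ ∈ innerDiffs A := by
  obtain ⟨x, hx, y, hy, hne, rfl⟩ := mem_innerDiffs.1 h
  exact mem_innerDiffs.2 ⟨y, hy, x, hx, hne.symm, (neg_sub x y).symm⟩

/-- The ones of the pattern `S` in channel `i`. -/
def fiber {M L : ℕ} [NeZero L] (S : Finset (Fin M × ZMod L)) (i : Fin M) : Finset (ZMod L) :=
  univ.filter fun x => (i, x) ∈ S

lemma mem_fiber {M L : ℕ} [NeZero L] {S : Finset (Fin M × ZMod L)} {i : Fin M} {x : ZMod L} :
    x ∈ fiber S i ↔ (i, x) ∈ S := by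
  simp [fiber]

lemma sum_card_fiber {M L : ℕ} [NeZero L] (S : Finset (Fin M × ZMod L)) :
    ∑ i, (fiber S i).card = S.card := by
  rw [← card_sigma]
  refine card_bij (fun p _ => (p.1, p.2)) ?_ ?_ ?_
  · rintro ⟨i, x⟩ h
    simpa [mem_fiber] using h
  · rintro ⟨i, x⟩ - ⟨j, y⟩ - h
    simpa using h
  · rintro ⟨i, x⟩ h
    exact ⟨⟨i, x⟩, by simpa [mem_fiber] using h, rfl⟩

/-- Distinct codewords have no difference in common: two ones of `S` and two ones of `S'` in the
same channels and with the same time difference would overlap simultaneously. -/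
lemma IsMCCAC.eq_of_sub_eq {M L w : ℕ} {C : Finset (Finset (Fin M × ZMod L))}
    (hC : IsMCCAC M L w C) {S S' : Finset (Fin M × ZMod L)} (hS : S ∈ C) (hS' : S' ∈ C)
    {i j : Fin M} {x y x' y' : ZMod L} (hx : (i, x) ∈ S) (hy : (j, y) ∈ S)
    (hne : (i, x) ≠ (j, y)) (hx' : (i, x') ∈ S') (hy' : (j, y') ∈ S')
    (h : x - y = x' - y') : S = S' := by
  by_contra hSS
  have h1 := hC.2 S hS S' hS' hSS (x' - x)
  refine absurd h1 (not_le.2 (one_lt_card.2 ⟨(i, x), ?_, (j, y), ?_, hne⟩))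
  · simpa [hx] using hx'
  · have : y + (x' - x) = y' := by linear_combination -h
    simpa [hy, this] using hy'

/-- Double counting of weighted differences. If every codeword has weight at least `N`, where a
difference `δ` inside a channel has weight `β δ` and a difference between two channels has
weight `α`, then the total weight of all differences bounds the size of the code. -/
lemma IsMCCAC.card_mul_le {M L w : ℕ} [NeZero L] {C : Finset (Finset (Fin M × ZMod L))}
    (hC : IsMCCAC M L w C) (α N : ℕ) (β : ZMod L → ℕ)
    (hN : ∀ S ∈ C, N ≤ ∑ i, ∑ δ ∈ innerDiffs (fiber S i), β δ +
      α * ∑ i, ∑ j ∈ univ.erase i, (fiber S i - fiber S j).card) :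
    C.card * N ≤ M * ∑ δ ∈ univ.erase 0, β δ + α * (M * (M - 1) * L) := by
  have hdiag : ∀ i : Fin M,
      ∑ S ∈ C, ∑ δ ∈ innerDiffs (fiber S i), β δ ≤ ∑ δ ∈ univ.erase 0, β δ := by
    intro i
    rw [← sum_biUnion]
    · refine sum_le_sum_of_subset fun δ hδ => ?_
      obtain ⟨S, -, hδ⟩ := mem_biUnion.1 hδ
      refine mem_erase.2 ⟨?_, mem_univ _⟩
      rintro rfl
      exact zero_notMem_innerDiffs _ hδ
    · intro S hS S' hS' hSS
      refine disjoint_left.2 fun δ hδ hδ' => hSS ?_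
      obtain ⟨x, hx, y, hy, hne, h⟩ := mem_innerDiffs.1 hδ
      obtain ⟨x', hx', y', hy', -, h'⟩ := mem_innerDiffs.1 hδ'
      exact hC.eq_of_sub_eq hS hS' (mem_fiber.1 hx) (mem_fiber.1 hy) (by simpa using hne)
        (mem_fiber.1 hx') (mem_fiber.1 hy') (h.trans h'.symm)
  have hoff : ∀ i : Fin M, ∀ j ∈ univ.erase i,
      ∑ S ∈ C, (fiber S i - fiber S j).card ≤ L := by
    intro i j hij
    rw [← card_biUnion]
    · refine (card_le_univ _).trans ?_
      rw [ZMod.card]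
    · intro S hS S' hS' hSS
      refine disjoint_left.2 fun δ hδ hδ' => hSS ?_
      obtain ⟨x, hx, y, hy, h⟩ := mem_sub.1 hδ
      obtain ⟨x', hx', y', hy', h'⟩ := mem_sub.1 hδ'
      exact hC.eq_of_sub_eq hS hS' (mem_fiber.1 hx) (mem_fiber.1 hy)
        (by simp [(ne_of_mem_erase hij).symm])
        (mem_fiber.1 hx') (mem_fiber.1 hy') (h.trans h'.symm)
  calc C.card * N = ∑ _S ∈ C, N := by simp
    _ ≤ ∑ S ∈ C, (∑ i, ∑ δ ∈ innerDiffs (fiber S i), β δ +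
          α * ∑ i, ∑ j ∈ univ.erase i, (fiber S i - fiber S j).card) := sum_le_sum hN
    _ = ∑ i, ∑ S ∈ C, ∑ δ ∈ innerDiffs (fiber S i), β δ +
          α * ∑ i, ∑ j ∈ univ.erase i, ∑ S ∈ C, (fiber S i - fiber S j).card := by
        rw [sum_add_distrib, ← mul_sum, sum_comm]
        congr 2
        rw [sum_comm]
        exact sum_congr rfl fun i _ => sum_comm
    _ ≤ ∑ _i : Fin M, ∑ δ ∈ univ.erase 0, β δ +
          α * ∑ i : Fin M, ∑ _j ∈ univ.erase i, L := by
        gcongr with i _ i _ j hj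
        · exact hdiag i
        · exact hoff i j hj
    _ = _ := by simp [mul_assoc]

/-! ### Weight of a single codeword -/

lemma card_mul_card_le_card_sub {R : Type*} [AddGroup R] [DecidableEq R] {A B : Finset R}
    (h : A.card ≤ 1 ∨ B.card ≤ 1) : A.card * B.card ≤ (A - B).card := by
  rcases A.eq_empty_or_nonempty with rfl | hA
  · simp
  rcases B.eq_empty_or_nonempty with rfl | hB
  · simp
  rcases h with h | h
  · calc A.card * B.card ≤ 1 * B.card := by gcongr
      _ ≤ _ := by simpa using card_le_card_sub_left hA
  · calc A.card * B.card ≤ A.card * 1 := by gcongr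
      _ ≤ _ := by simpa using card_le_card_sub_right hB

/-- For `w ≤ 4`, either a codeword has a channel such that it has at most one element in every
other channel, or it consists of two pairs in two channels. In the first case, with `n` elements in
the distinguished channel, there are exactly `(w - n) * (w + n - 1)` differences between distinct
channels. -/
lemma le_weight_of_profile {M L w : ℕ} [NeZero L] (hw0 : 0 < w) (hw : w ≤ 4) (α N : ℕ)
    (β : ZMod L → ℕ)
    (h1 : ∀ A : Finset (ZMod L), A.Nonempty → A.card ≤ w →
      N ≤ ∑ δ ∈ innerDiffs A, β δ + α * ((w - A.card) * (w + A.card - 1)))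
    (h2 : w = 4 → ∀ A B : Finset (ZMod L), A.card = 2 → B.card = 2 →
      N ≤ ∑ δ ∈ innerDiffs A, β δ + ∑ δ ∈ innerDiffs B, β δ + α * ((A - B).card + (B - A).card))
    (S : Finset (Fin M × ZMod L)) (hS : S.card = w) :
    N ≤ ∑ i, ∑ δ ∈ innerDiffs (fiber S i), β δ +
      α * ∑ i, ∑ j ∈ univ.erase i, (fiber S i - fiber S j).card := by
  have hsum := sum_card_fiber S
  rw [hS] at hsum
  obtain ⟨⟨i', x'⟩, hi'⟩ : S.Nonempty := card_pos.1 (hS ▸ hw0)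
  obtain ⟨i, -, hmax⟩ := exists_max_image (univ : Finset (Fin M)) (fun i => (fiber S i).card)
    ⟨i', mem_univ _⟩
  have hpos : 0 < (fiber S i).card :=
    (card_pos.2 ⟨x', mem_fiber.2 hi'⟩).trans_le (hmax i' (mem_univ _))
  have hi : (fiber S i).card + ∑ j ∈ univ.erase i, (fiber S j).card = w := by
    rw [add_sum_erase _ (fun j => (fiber S j).card) (mem_univ i), hsum]
  have hall : ∀ j, (fiber S j).card + ∑ k ∈ univ.erase j, (fiber S k).card = w := fun j => by
    rw [add_sum_erase _ (fun j => (fiber S j).card) (mem_univ j), hsum]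
  by_cases hj : ∃ j ∈ univ.erase i, 2 ≤ (fiber S j).card
  · obtain ⟨j, hji, hj⟩ := hj
    have hle := single_le_sum (f := fun j => (fiber S j).card) (fun _ _ => Nat.zero_le _) hji
    have hm := hmax j (mem_univ _)
    have hij : i ∈ univ.erase j := mem_erase.2 ⟨(ne_of_mem_erase hji).symm, mem_univ _⟩
    refine (h2 (by omega) (fiber S i) (fiber S j) (by omega) (by omega)).trans ?_
    have e1 : ∑ δ ∈ innerDiffs (fiber S i), β δ + ∑ δ ∈ innerDiffs (fiber S j), β δ ≤
        ∑ i, ∑ δ ∈ innerDiffs (fiber S i), β δ := by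
      rw [← add_sum_erase univ _ (mem_univ i)]
      gcongr
      exact single_le_sum (f := fun j => ∑ δ ∈ innerDiffs (fiber S j), β δ)
        (fun _ _ => Nat.zero_le _) hji
    have e2 : (fiber S i - fiber S j).card + (fiber S j - fiber S i).card ≤
        ∑ i, ∑ j ∈ univ.erase i, (fiber S i - fiber S j).card := by
      rw [← add_sum_erase univ _ (mem_univ i)]
      refine add_le_add ?_ (le_trans ?_ (single_le_sum
        (f := fun j => ∑ k ∈ univ.erase j, (fiber S j - fiber S k).card)
        (fun _ _ => Nat.zero_le _) hji))
      · exact single_le_sum (f := fun j => (fiber S i - fiber S j).card)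
          (fun _ _ => Nat.zero_le _) hji
      · exact single_le_sum (f := fun k => (fiber S j - fiber S k).card)
          (fun _ _ => Nat.zero_le _) hij
    gcongr
  · push Not at hj
    have e1 : ∑ δ ∈ innerDiffs (fiber S i), β δ ≤ ∑ i, ∑ δ ∈ innerDiffs (fiber S i), β δ :=
      single_le_sum (f := fun j => ∑ δ ∈ innerDiffs (fiber S j), β δ)
        (fun _ _ => Nat.zero_le _) (mem_univ i)
    have e2 : (w - (fiber S i).card) * (w + (fiber S i).card - 1) ≤
        ∑ i, ∑ j ∈ univ.erase i, (fiber S i - fiber S j).card := by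
      calc (w - (fiber S i).card) * (w + (fiber S i).card - 1)
          = (fiber S i).card * (w - (fiber S i).card) +
              (w - (fiber S i).card) * (w - 1) := by
            have : w + (fiber S i).card - 1 = (fiber S i).card + (w - 1) := by omega
            rw [this]
            ring
        _ = (fiber S i).card * ∑ j ∈ univ.erase i, (fiber S j).card +
              ∑ j ∈ univ.erase i, (fiber S j).card * (w - 1) := by
            rw [← sum_mul]
            congr 2 <;> omega
        _ = (fiber S i).card * ∑ j ∈ univ.erase i, (fiber S j).card +
              ∑ j ∈ univ.erase i, (fiber S j).card * ∑ k ∈ univ.erase j, (fiber S k).card := by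
            congr 1
            refine sum_congr rfl fun j hji => ?_
            have := hall j
            have := hj j hji
            obtain h | h : (fiber S j).card = 0 ∨ (fiber S j).card = 1 := by omega
            · simp [h]
            · congr 1
              omega
        _ = ∑ i, ∑ j ∈ univ.erase i, (fiber S i).card * (fiber S j).card := by
            simp_rw [mul_sum]
            exact add_sum_erase univ
              (fun i => ∑ j ∈ univ.erase i, (fiber S i).card * (fiber S j).card) (mem_univ i)
        _ ≤ _ := by
            refine sum_le_sum fun j _ => sum_le_sum fun k hk => card_mul_card_le_card_sub ?_
            by_cases h : j = i
            · right
              subst h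
              exact Nat.le_of_lt_succ (hj k hk)
            · left
              exact Nat.le_of_lt_succ (hj j (mem_erase.2 ⟨h, mem_univ _⟩))
    have := h1 (fiber S i) (card_pos.1 hpos) (by omega)
    refine this.trans ?_
    gcongr

/-! ### Weights inside a channel -/

/-- Weight of a difference inside a channel for `w = 3`; differences between channels weigh `2`,
and every codeword weighs at least `12`. -/
def tripleWeight {R : Type*} [CommRing R] [DecidableEq R] (δ : R) : ℕ :=
  3 + (if 2 * δ = 0 then 3 else 0) + (if 3 * δ = 0 then 3 else 0)

/-- Weight of a difference inside a channel for `w = 4` in the absence of elements of order three;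
differences between channels weigh `1`, and every codeword weighs at least `12`. -/
def quadWeight {R : Type*} [CommRing R] [DecidableEq R] (δ : R) : ℕ :=
  2 + (if 2 * δ = 0 then 6 else 0) + (if 5 * δ = 0 then 1 else 0)

lemma sum_map_le_sum {R : Type*} [DecidableEq R] {D : Finset R} (β : R → ℕ) (l : List R)
    (hl : l.Nodup) (h : ∀ x ∈ l, x ∈ D) : (l.map β).sum ≤ ∑ δ ∈ D, β δ := by
  rw [← List.sum_toFinset β hl]
  exact sum_le_sum_of_subset fun x hx => h x (List.mem_toFinset.1 hx)

section Weights

variable {R : Type*} [CommRing R] [DecidableEq R]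

lemma three_le_tripleWeight (δ : R) : 3 ≤ tripleWeight δ := by
  unfold tripleWeight; omega

lemma two_le_quadWeight (δ : R) : 2 ≤ quadWeight δ := by
  unfold quadWeight; omega

lemma twelve_le_sum_tripleWeight {A : Finset R} (hA : A.card = 3) :
    12 ≤ ∑ δ ∈ innerDiffs A, tripleWeight δ := by
  obtain ⟨x, y, z, hxy, hxz, hyz, rfl⟩ := card_eq_three.1 hA
  set D := innerDiffs ({x, y, z} : Finset R) with hD
  have h0 : (0 : R) ∉ D := zero_notMem_innerDiffs _
  have hneg : ∀ δ ∈ D, -δ ∈ D := fun δ => neg_mem_innerDiffs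
  by_cases h3 : ∃ δ ∈ D, 3 * δ = 0
  · obtain ⟨δ, hδ, h3⟩ := h3
    have hδ0 : δ ≠ 0 := by rintro rfl; exact h0 hδ
    have := sum_map_le_sum (D := D) tripleWeight [δ, -δ]
      (by simp only [List.nodup_cons, List.mem_singleton]
          refine ⟨fun h => hδ0 ?_, by simp⟩
          linear_combination h3 - h)
      (by simpa using ⟨hδ, hneg δ hδ⟩)
    refine le_trans ?_ this
    have h3' : 3 * (-δ) = 0 := by linear_combination -h3
    simp only [tripleWeight, h3, h3', List.map_cons, List.map_nil, List.sum_cons, List.sum_nil]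
    simp
    omega
  push Not at h3
  by_cases h2 : ∃ δ ∈ D, 2 * δ = 0
  · obtain ⟨δ, hδ, h2⟩ := h2
    obtain ⟨p, hp, q, hq, hpq, rfl⟩ := mem_innerDiffs.1 hδ
    obtain ⟨r, hr, hr'⟩ := exists_mem_notMem_of_card_lt_card
      ((card_le_two (a := p) (b := q)).trans_lt (hA.symm ▸ (by norm_num : 2 < 3)))
    simp only [mem_insert (b := p), mem_singleton, not_or] at hr'
    obtain ⟨hrp, hrq⟩ := hr'
    have := sum_map_le_sum (D := D) tripleWeight [p - q, p - r, q - r]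
      (by simp only [List.nodup_cons, List.mem_cons, List.not_mem_nil]
          grind)
      (by simpa using ⟨hδ, sub_mem_innerDiffs hp hr (Ne.symm hrp),
        sub_mem_innerDiffs hq hr (Ne.symm hrq)⟩)
    refine le_trans ?_ this
    have e1 := three_le_tripleWeight (p - r)
    have e2 := three_le_tripleWeight (q - r)
    have e3 : 6 ≤ tripleWeight (p - q) := by
      unfold tripleWeight
      rw [if_pos h2]
      omega
    simp only [List.map_cons, List.map_nil, List.sum_cons, List.sum_nil]
    omega
  push Not at h2
  have ha : x - y ∈ D := sub_mem_innerDiffs (by simp) (by simp) hxy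
  have hb : y - z ∈ D := sub_mem_innerDiffs (by simp) (by simp) hyz
  have hc : x - z ∈ D := sub_mem_innerDiffs (by simp) (by simp) hxz
  have four : ∀ u ∈ D, ∀ v ∈ D, u ≠ v → u ≠ -v → 12 ≤ ∑ δ ∈ D, tripleWeight δ := by
    intro u hu v hv huv huv'
    have := sum_map_le_sum (D := D) tripleWeight [u, -u, v, -v]
      (by have := h2 u hu
          have := h2 v hv
          simp only [List.nodup_cons, List.mem_cons, List.not_mem_nil]
          grind)
      (by simpa using ⟨hu, hneg u hu, hv, hneg v hv⟩)
    refine le_trans ?_ this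
    have e1 := three_le_tripleWeight u
    have e2 := three_le_tripleWeight v
    have e3 := three_le_tripleWeight (-u)
    have e4 := three_le_tripleWeight (-v)
    simp only [List.map_cons, List.map_nil, List.sum_cons, List.sum_nil]
    omega
  by_cases hab : x - y = y - z
  · refine four (x - y) ha (x - z) hc (fun h => hyz ?_) (fun h => h3 (x - y) ha ?_)
    · linear_combination -h
    · linear_combination hab + h
  · refine four (x - y) ha (y - z) hb hab (fun h => hxz ?_)
    linear_combination h

lemma four_le_sum_tripleWeight {A : Finset R} (hA : A.card = 2) :
    4 ≤ ∑ δ ∈ innerDiffs A, tripleWeight δ := by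
  obtain ⟨x, y, hxy, rfl⟩ := card_eq_two.1 hA
  have ha : x - y ∈ innerDiffs ({x, y} : Finset R) :=
    sub_mem_innerDiffs (by simp) (by simp) hxy
  by_cases h2 : 2 * (x - y) = 0
  · refine le_trans ?_ (single_le_sum (fun _ _ => Nat.zero_le _) ha)
    unfold tripleWeight
    rw [if_pos h2]
    omega
  · have := sum_map_le_sum tripleWeight [x - y, -(x - y)]
      (by simp only [List.nodup_cons, List.mem_singleton]
          refine ⟨fun h => h2 ?_, by simp⟩
          linear_combination h)
      (by simpa using ⟨ha, by simpa using neg_mem_innerDiffs ha⟩)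
    refine le_trans ?_ this
    have e1 := three_le_tripleWeight (x - y)
    have e2 := three_le_tripleWeight (-(x - y))
    simp only [List.map_cons, List.map_nil, List.sum_cons, List.sum_nil]
    omega

lemma four_le_sum_quadWeight {A : Finset R} (hA : A.card = 2) :
    4 ≤ ∑ δ ∈ innerDiffs A, quadWeight δ := by
  obtain ⟨x, y, hxy, rfl⟩ := card_eq_two.1 hA
  have ha : x - y ∈ innerDiffs ({x, y} : Finset R) :=
    sub_mem_innerDiffs (by simp) (by simp) hxy
  by_cases h2 : 2 * (x - y) = 0
  · refine le_trans ?_ (single_le_sum (fun _ _ => Nat.zero_le _) ha)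
    unfold quadWeight
    rw [if_pos h2]
    omega
  · have := sum_map_le_sum quadWeight [x - y, -(x - y)]
      (by simp only [List.nodup_cons, List.mem_singleton]
          refine ⟨fun h => h2 ?_, by simp⟩
          linear_combination h)
      (by simpa using ⟨ha, by simpa using neg_mem_innerDiffs ha⟩)
    refine le_trans ?_ this
    have e1 := two_le_quadWeight (x - y)
    have e2 := two_le_quadWeight (-(x - y))
    simp only [List.map_cons, List.map_nil, List.sum_cons, List.sum_nil]
    omega

lemma six_le_sum_quadWeight (ht : ∀ x : R, 3 * x = 0 → x = 0) {A : Finset R} (hA : A.card = 3) :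
    6 ≤ ∑ δ ∈ innerDiffs A, quadWeight δ := by
  obtain ⟨x, y, z, hxy, hxz, hyz, rfl⟩ := card_eq_three.1 hA
  set D := innerDiffs ({x, y, z} : Finset R) with hD
  have hneg : ∀ δ ∈ D, -δ ∈ D := fun δ => neg_mem_innerDiffs
  by_cases h2 : ∃ δ ∈ D, 2 * δ = 0
  · obtain ⟨δ, hδ, h2⟩ := h2
    refine le_trans ?_ (single_le_sum (fun _ _ => Nat.zero_le _) hδ)
    unfold quadWeight
    rw [if_pos h2]
    omega
  push Not at h2
  have ha : x - y ∈ D := sub_mem_innerDiffs (by simp) (by simp) hxy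
  have hb : y - z ∈ D := sub_mem_innerDiffs (by simp) (by simp) hyz
  have hc : x - z ∈ D := sub_mem_innerDiffs (by simp) (by simp) hxz
  have three : ∀ v ∈ D, x - y ≠ v → x - y ≠ -v → 6 ≤ ∑ δ ∈ D, quadWeight δ := by
    intro v hv huv huv'
    have := sum_map_le_sum (D := D) quadWeight [x - y, -(x - y), v]
      (by have := h2 (x - y) ha
          simp only [List.nodup_cons, List.mem_cons, List.not_mem_nil]
          grind)
      (by simpa using ⟨ha, by simpa using hneg _ ha, hv⟩)
    refine le_trans ?_ this
    have e1 := two_le_quadWeight (x - y)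
    have e2 := two_le_quadWeight (-(x - y))
    have e3 := two_le_quadWeight v
    simp only [List.map_cons, List.map_nil, List.sum_cons, List.sum_nil]
    omega
  by_cases hac : x - y = z - x
  · refine three (y - z) hb (fun h => hxy ?_) (fun h => hxz ?_)
    · refine sub_eq_zero.1 (ht _ ?_)
      linear_combination hac + h
    · linear_combination h
  · refine three (x - z) hc (fun h => hyz ?_) (fun h => hac ?_)
    · linear_combination -h
    · linear_combination h

/-- A symmetric set without involutions that contains three elements, no two of them equal or
opposite, has weight at least `12`. -/
lemma twelve_le_of_three_pairs {D : Finset R} (hneg : ∀ δ ∈ D, -δ ∈ D)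
    (h2 : ∀ δ ∈ D, 2 * δ ≠ 0) {a b c : R} (ha : a ∈ D) (hb : b ∈ D) (hc : c ∈ D)
    (hab : a ≠ b) (hab' : a ≠ -b) (hac : a ≠ c) (hac' : a ≠ -c) (hbc : b ≠ c) (hbc' : b ≠ -c) :
    12 ≤ ∑ δ ∈ D, quadWeight δ := by
  have := sum_map_le_sum (D := D) quadWeight [a, -a, b, -b, c, -c]
    (by have := h2 a ha
        have := h2 b hb
        have := h2 c hc
        simp only [List.nodup_cons, List.mem_cons, List.not_mem_nil]
        grind)
    (by simpa using ⟨ha, hneg a ha, hb, hneg b hb, hc, hneg c hc⟩)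
  refine le_trans ?_ this
  have e1 := two_le_quadWeight a
  have e2 := two_le_quadWeight b
  have e3 := two_le_quadWeight c
  have e4 := two_le_quadWeight (-a)
  have e5 := two_le_quadWeight (-b)
  have e6 := two_le_quadWeight (-c)
  simp only [List.map_cons, List.map_nil, List.sum_cons, List.sum_nil]
  omega

/-- The set contains six elements, unless `a` has order five, when `±a`, `±2a` weigh `3` each. -/
lemma twelve_le_of_multiples {D : Finset R} (h0 : 0 ∉ D) (hneg : ∀ δ ∈ D, -δ ∈ D)
    (h2 : ∀ δ ∈ D, 2 * δ ≠ 0) {a : R} (ha : a ∈ D) (h2a : 2 * a ∈ D) (h3a : 3 * a ∈ D) :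
    12 ≤ ∑ δ ∈ D, quadWeight δ := by
  have n1 : a ≠ 0 := by rintro rfl; exact h0 ha
  have n2 : 2 * a ≠ 0 := h2 a ha
  have n3 : 3 * a ≠ 0 := by intro h; rw [h] at h3a; exact h0 h3a
  have n4 : 4 * a ≠ 0 := by have := h2 _ h2a; contrapose! this; linear_combination this
  by_cases h5 : 5 * a = 0
  · have := sum_map_le_sum (D := D) quadWeight [a, -a, 2 * a, -(2 * a)]
      (by simp only [List.nodup_cons, List.mem_cons, List.not_mem_nil]
          grind)
      (by simpa using ⟨ha, hneg a ha, h2a, hneg _ h2a⟩)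
    refine le_trans ?_ this
    have e1 : 5 * (-a) = 0 := by linear_combination -h5
    have e2 : 5 * (2 * a) = 0 := by linear_combination 2 * h5
    have e3 : 5 * -(2 * a) = 0 := by linear_combination -2 * h5
    simp only [List.map_cons, List.map_nil, List.sum_cons, List.sum_nil, quadWeight, h5, e1, e2, e3,
      if_true]
    omega
  · refine twelve_le_of_three_pairs hneg h2 ha h2a h3a ?_ ?_ ?_ ?_ ?_ ?_ <;> intro h
    · exact n1 (by linear_combination -h)
    · exact n3 (by linear_combination h)
    · exact n2 (by linear_combination -h)
    · exact n4 (by linear_combination h)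
    · exact n1 (by linear_combination -h)
    · exact h5 (by linear_combination h)

/-- The case that `D` contains the differences of `{-a, 0, a, c}`. -/
lemma twelve_le_of_opposite {D : Finset R} (h0 : 0 ∉ D) (hneg : ∀ δ ∈ D, -δ ∈ D)
    (h2 : ∀ δ ∈ D, 2 * δ ≠ 0) (ht : ∀ x : R, 3 * x = 0 → x = 0) {a c : R} (ha : a ∈ D)
    (h2a : 2 * a ∈ D) (hc : c ∈ D) (hca : c - a ∈ D) (hca' : c + a ∈ D) :
    12 ≤ ∑ δ ∈ D, quadWeight δ := by
  have n1 : a ≠ 0 := by rintro rfl; exact h0 ha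
  have m1 : c ≠ a := by rintro rfl; exact h0 (by simpa using hca)
  have m2 : c ≠ -a := by rintro rfl; exact h0 (by simpa using hca')
  by_cases h : c = 2 * a
  · subst h
    exact twelve_le_of_multiples h0 hneg h2 ha h2a (by convert hca' using 1; ring)
  by_cases h' : c = -(2 * a)
  · subst h'
    refine twelve_le_of_multiples h0 hneg h2 (hneg a ha) (by convert hc using 1; ring)
      (by convert hca using 1; ring)
  refine twelve_le_of_three_pairs hneg h2 ha h2a hc ?_ ?_ m1.symm ?_ ?_ ?_
  · exact fun e => n1 (by linear_combination -e)
  · exact fun e => n1 (ht a (by linear_combination e))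
  · exact fun e => m2 (by linear_combination e)
  · exact fun e => h e.symm
  · exact fun e => h' (by linear_combination e)

lemma twelve_le_sum_quadWeight (ht : ∀ x : R, 3 * x = 0 → x = 0) {A : Finset R}
    (hA : A.card = 4) : 12 ≤ ∑ δ ∈ innerDiffs A, quadWeight δ := by
  obtain ⟨x, y, z, t, hxy, hxz, hxt, hyz, hyt, hzt, rfl⟩ := card_eq_four.1 hA
  set D := innerDiffs ({x, y, z, t} : Finset R) with hD
  have h0 : (0 : R) ∉ D := zero_notMem_innerDiffs _
  have hneg : ∀ δ ∈ D, -δ ∈ D := fun δ => neg_mem_innerDiffs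
  by_cases h2 : ∃ δ ∈ D, 2 * δ = 0
  · obtain ⟨δ, hδ, h2⟩ := h2
    obtain ⟨p, hp, q, hq, hpq, rfl⟩ := mem_innerDiffs.1 hδ
    obtain ⟨r, hr, hr'⟩ := exists_mem_notMem_of_card_lt_card
      ((card_le_two (a := p) (b := q)).trans_lt (hA.symm ▸ (by norm_num : 2 < 4)))
    simp only [mem_insert (b := p), mem_singleton, not_or] at hr'
    obtain ⟨hrp, hrq⟩ := hr'
    have := sum_map_le_sum (D := D) quadWeight [p - q, p - r, q - r]
      (by simp only [List.nodup_cons, List.mem_cons, List.not_mem_nil]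
          grind)
      (by simpa using ⟨hδ, sub_mem_innerDiffs hp hr (Ne.symm hrp),
        sub_mem_innerDiffs hq hr (Ne.symm hrq)⟩)
    refine le_trans ?_ this
    have e1 := two_le_quadWeight (p - r)
    have e2 := two_le_quadWeight (q - r)
    have e3 : 8 ≤ quadWeight (p - q) := by
      unfold quadWeight
      rw [if_pos h2]
      omega
    simp only [List.map_cons, List.map_nil, List.sum_cons, List.sum_nil]
    omega
  push Not at h2
  have hD' : ∀ p ∈ ({x, y, z, t} : Finset R), ∀ q ∈ ({x, y, z, t} : Finset R), p ≠ q → p - q ∈ D :=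
    fun p hp q hq h => sub_mem_innerDiffs hp hq h
  -- If two of the differences `y - x`, `z - x`, `t - x` are opposite, the midpoint `x` of the
  -- corresponding two elements exhibits an arithmetic progression in `A`.
  have opp : ∀ p ∈ ({x, y, z, t} : Finset R), ∀ q ∈ ({x, y, z, t} : Finset R),
      ∀ r ∈ ({x, y, z, t} : Finset R), p ≠ q → x ≠ p → x ≠ q → x ≠ r → p ≠ r → q ≠ r →
      p - x = -(q - x) → 12 ≤ ∑ δ ∈ D, quadWeight δ := by
    intro p hp q hq r hr hpq hxp hxq hxr hpr hqr h
    have hx : x ∈ ({x, y, z, t} : Finset R) := by simp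
    refine twelve_le_of_opposite h0 hneg h2 ht (hD' p hp x hx hxp.symm) ?_
      (hD' r hr x hx hxr.symm) ?_ ?_
    · convert hD' p hp q hq hpq using 1
      linear_combination h
    · convert hD' r hr p hp hpr.symm using 1
      ring
    · convert hD' r hr q hq hqr.symm using 1
      linear_combination h
  by_cases h1 : y - x = -(z - x)
  · exact opp y (by simp) z (by simp) t (by simp) hyz hxy hxz hxt hyt hzt h1
  by_cases h1' : y - x = -(t - x)
  · exact opp y (by simp) t (by simp) z (by simp) hyt hxy hxt hxz hyz hzt.symm h1'
  by_cases h1'' : z - x = -(t - x)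
  · exact opp z (by simp) t (by simp) y (by simp) hzt hxz hxt hxy hyz.symm hyt.symm h1''
  refine twelve_le_of_three_pairs hneg h2 (hD' y (by simp) x (by simp) hxy.symm)
    (hD' z (by simp) x (by simp) hxz.symm) (hD' t (by simp) x (by simp) hxt.symm)
    ?_ h1 ?_ h1' ?_ h1''
  · simpa using hyz
  · simpa using hyt
  · simpa using hzt

end Weights

/-! ### Steps of arithmetic progressions in a tight code -/

/-- The differences of an arithmetic progression of length three with step `a`. -/
def tripleSteps {R : Type*} [CommRing R] [DecidableEq R] (a : R) : Finset R :=
  {a, -a, 2 * a, -(2 * a)}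

/-- The differences of an arithmetic progression of length four with step `a`. -/
def quadSteps {R : Type*} [CommRing R] [DecidableEq R] (a : R) : Finset R :=
  {a, -a, 2 * a, -(2 * a), 3 * a, -(3 * a)}

/-- The sets `P a`, for `a` in `G`, cover the nonzero elements of `R`, and any two of them are equal
or disjoint. This is what the steps `a` of the codewords of an equi-difference tight code satisfy,
with `P a` the set of differences of a codeword with step `a`. -/
structure IsStepPartition {R : Type*} [CommRing R] (P : R → Finset R) (G : Set R) : Prop where
  zero_notMem : ∀ a ∈ G, 0 ∉ P a
  cover : ∀ δ : R, δ ≠ 0 → ∃ a ∈ G, δ ∈ P a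
  eq_of_mem : ∀ a ∈ G, ∀ b ∈ G, ∀ δ, δ ∈ P a → δ ∈ P b → P a = P b

section Steps

variable {R : Type*} [CommRing R] [DecidableEq R] {G : Set R}

lemma mem_tripleSteps {a δ : R} :
    δ ∈ tripleSteps a ↔ δ = a ∨ δ = -a ∨ δ = 2 * a ∨ δ = -(2 * a) := by
  simp [tripleSteps]

lemma mem_quadSteps {a δ : R} :
    δ ∈ quadSteps a ↔
      δ = a ∨ δ = -a ∨ δ = 2 * a ∨ δ = -(2 * a) ∨ δ = 3 * a ∨ δ = -(3 * a) := by
  simp [quadSteps]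

namespace IsStepPartition

/-- The elements `1` and `1 + h` are odd, hence `±` steps, and have the same double `2`. -/
lemma four_eq_zero (hG : IsStepPartition tripleSteps G) {h : R} (h0 : h ≠ 0) (h2 : 2 * h = 0) :
    (4 : R) = 0 := by
  have hodd : ∀ z : R, 1 ≠ 2 * z := fun z hz => h0 (by linear_combination h * hz + z * h2)
  have hne := fun a ha => hG.zero_notMem a ha
  simp only [mem_tripleSteps] at hne
  obtain ⟨c, hc⟩ : ∃ c, h = 2 * c := by
    obtain ⟨a, ha, hm⟩ := hG.cover h h0
    have := hne a ha
    rcases mem_tripleSteps.1 hm with e | e | e | e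
    · exact absurd (by linear_combination -h2 + 2 * e : 0 = 2 * a) (by tauto)
    · exact absurd (by linear_combination h2 - 2 * e : 0 = 2 * a) (by tauto)
    · exact ⟨a, e⟩
    · exact ⟨-a, by linear_combination e⟩
  have step : ∀ x : R, (∀ z, x ≠ 2 * z) → ∃ a ∈ G, x = a ∨ x = -a := by
    intro x hx
    obtain ⟨a, ha, hm⟩ := hG.cover x (by simpa using hx 0)
    rcases mem_tripleSteps.1 hm with e | e | e | e
    · exact ⟨a, ha, .inl e⟩
    · exact ⟨a, ha, .inr e⟩
    · exact absurd e (hx a)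
    · exact absurd (by linear_combination e) (hx (-a))
  obtain ⟨a, ha, ha'⟩ := step 1 hodd
  have hodd' : ∀ z : R, 1 + h ≠ 2 * z := fun z hz =>
    hodd (z - c) (by linear_combination hz - hc)
  obtain ⟨b, hb, hb'⟩ := step (1 + h) hodd'
  have e := hG.eq_of_mem a ha b hb 2
    (mem_tripleSteps.2 (by
      rcases ha' with e | e
      · exact .inr (.inr (.inl (by linear_combination 2 * e)))
      · exact .inr (.inr (.inr (by linear_combination 2 * e)))))
    (mem_tripleSteps.2 (by
      rcases hb' with e | e
      · exact .inr (.inr (.inl (by linear_combination 2 * e - h2)))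
      · exact .inr (.inr (.inr (by linear_combination 2 * e - h2)))))
  have hm : 1 + h ∈ tripleSteps a := by
    rw [e, mem_tripleSteps]
    tauto
  have hm' : 1 + h = 1 ∨ 1 + h = -1 := by
    rcases mem_tripleSteps.1 hm with e | e | e | e
    · rcases ha' with f | f
      · exact .inl (by linear_combination e - f)
      · exact .inr (by linear_combination e + f)
    · rcases ha' with f | f
      · exact .inr (by linear_combination e + f)
      · exact .inl (by linear_combination e - f)
    · exact absurd e (hodd' a)
    · exact absurd (by linear_combination e) (hodd' (-a))
  rcases hm' with e | e
  · exact absurd (by linear_combination e) h0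
  · linear_combination 2 * e - h2

/-- No step `a` has order six. -/
lemma six_mul_ne_zero (hG : IsStepPartition tripleSteps G) {a : R} (ha : a ∈ G)
    (h3 : 3 * a ≠ 0) : 6 * a ≠ 0 := by
  intro h6
  have h4 := hG.four_eq_zero h3 (by linear_combination h6)
  exact hG.zero_notMem a ha (mem_tripleSteps.2
    (.inr (.inr (.inl (by linear_combination a * h4 - h6)))))

/-- If the order of the ring is divisible by six, then `1` and one of `1 + u`, `1 - u` are coprime
to six, hence `±` steps, and have the same triple `3`. -/
lemma six_eq_zero (hG : IsStepPartition quadSteps G) {h u : R} (h0 : h ≠ 0) (h2 : 2 * h = 0)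
    (hu : u ≠ 0) (h3 : 3 * u = 0) : (6 : R) = 0 := by
  have hodd : ∀ z : R, 1 ≠ 2 * z := fun z hz => h0 (by linear_combination h * hz + z * h2)
  have hthree : ∀ z : R, 1 ≠ 3 * z := fun z hz => hu (by linear_combination u * hz + z * h3)
  have step : ∀ x : R, (∀ z, x ≠ 2 * z) → (∀ z, x ≠ 3 * z) → ∃ a ∈ G, x = a ∨ x = -a := by
    intro x hx hx'
    obtain ⟨a, ha, hm⟩ := hG.cover x (by simpa using hx 0)
    rcases mem_quadSteps.1 hm with e | e | e | e | e | e
    · exact ⟨a, ha, .inl e⟩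
    · exact ⟨a, ha, .inr e⟩
    · exact absurd e (hx a)
    · exact absurd (by linear_combination e) (hx (-a))
    · exact absurd e (hx' a)
    · exact absurd (by linear_combination e) (hx' (-a))
  obtain ⟨a, ha, ha'⟩ := step 1 hodd hthree
  have key : ∀ v : R, v ≠ 0 → 3 * v = 0 → (∀ z, 1 + v ≠ 3 * z) → (6 : R) = 0 := by
    intro v hv hv3 hv'
    have hodd' : ∀ z : R, 1 + v ≠ 2 * z := fun z hz =>
      hodd (z + v) (by linear_combination hz - hv3)
    obtain ⟨b, hb, hb'⟩ := step (1 + v) hodd' hv'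
    have e := hG.eq_of_mem a ha b hb 3
      (mem_quadSteps.2 (by
        rcases ha' with e | e
        · exact .inr (.inr (.inr (.inr (.inl (by linear_combination 3 * e)))))
        · exact .inr (.inr (.inr (.inr (.inr (by linear_combination 3 * e)))))))
      (mem_quadSteps.2 (by
        rcases hb' with e | e
        · exact .inr (.inr (.inr (.inr (.inl (by linear_combination 3 * e - hv3)))))
        · exact .inr (.inr (.inr (.inr (.inr (by linear_combination 3 * e - hv3)))))))
    have hm : 1 + v ∈ quadSteps a := by
      rw [e, mem_quadSteps]
      tauto
    have hm' : 1 + v = 1 ∨ 1 + v = -1 := by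
      rcases mem_quadSteps.1 hm with e | e | e | e | e | e
      · rcases ha' with f | f
        · exact .inl (by linear_combination e - f)
        · exact .inr (by linear_combination e + f)
      · rcases ha' with f | f
        · exact .inr (by linear_combination e + f)
        · exact .inl (by linear_combination e - f)
      · exact absurd e (hodd' a)
      · exact absurd (by linear_combination e) (hodd' (-a))
      · exact absurd e (hv' a)
      · exact absurd (by linear_combination e) (hv' (-a))
    rcases hm' with e | e
    · exact absurd (by linear_combination e) hv
    · linear_combination 3 * e - hv3
  by_cases hp : ∀ z, 1 + u ≠ 3 * z
  · exact key u hu h3 hp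
  · push Not at hp
    obtain ⟨z, hz⟩ := hp
    refine key (-u) (neg_ne_zero.2 hu) (by linear_combination -h3) fun z' hz' => ?_
    exact hthree (1 - z - z') (by linear_combination -hz - hz')

/-- Without involutions there are no elements of order three: the elements outside `3R` are the
`±` steps outside `3R` and their doubles, while tripling maps these steps injectively to the nonzero
elements of `3R`; but `3R` contains at most a third of the ring. -/
lemma eq_zero_of_three_mul [Fintype R] (hG : IsStepPartition quadSteps G)
    (h2 : ∀ x : R, 2 * x = 0 → x = 0) {u : R} (h3 : 3 * u = 0) : u = 0 := by
  classical
  by_contra hu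
  set K : Finset R := univ.image fun z => 3 * z with hK
  have memK : ∀ x, x ∈ K ↔ ∃ z, 3 * z = x := by simp [hK]
  set S : Finset R := univ.filter fun x => x ∉ K ∧ ∃ a ∈ G, x = a ∨ x = -a with hS
  have memS : ∀ x, x ∈ S ↔ x ∉ K ∧ ∃ a ∈ G, x = a ∨ x = -a := by simp [hS]
  have hne := fun a ha => hG.zero_notMem a ha
  simp only [mem_quadSteps] at hne
  have hcover : univ \ K ⊆ S ∪ S.image fun x => 2 * x := by
    intro x hx
    have hxK : x ∉ K := (mem_sdiff.1 hx).2
    obtain ⟨a, ha, hm⟩ := hG.cover x (by rintro rfl; exact hxK ((memK 0).2 ⟨0, by simp⟩))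
    rw [mem_union, mem_image]
    rcases mem_quadSteps.1 hm with e | e | e | e | e | e
    · exact .inl ((memS x).2 ⟨hxK, a, ha, .inl e⟩)
    · exact .inl ((memS x).2 ⟨hxK, a, ha, .inr e⟩)
    · refine .inr ⟨a, (memS a).2 ⟨fun h => hxK ?_, a, ha, .inl rfl⟩, e.symm⟩
      obtain ⟨z, hz⟩ := (memK a).1 h
      exact (memK x).2 ⟨2 * z, by linear_combination 2 * hz - e⟩
    · refine .inr ⟨-a, (memS _).2 ⟨fun h => hxK ?_, a, ha, .inr rfl⟩, by linear_combination -e⟩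
      obtain ⟨z, hz⟩ := (memK _).1 h
      exact (memK x).2 ⟨2 * z, by linear_combination 2 * hz - e⟩
    · exact absurd ((memK x).2 ⟨a, e.symm⟩) hxK
    · exact absurd ((memK x).2 ⟨-a, by linear_combination -e⟩) hxK
  have hS3 : S.card ≤ (K.erase 0).card := by
    have hx3 : ∀ x ∈ S, 3 * x ≠ 0 := by
      intro x hx h
      obtain ⟨-, a, ha, e⟩ := (memS x).1 hx
      have h0 := hne a ha
      rcases e with e | e
      · exact h0 (by right; right; right; right; left; linear_combination 3 * e - h)
      · exact h0 (by right; right; right; right; left; linear_combination -3 * e + h)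
    refine card_le_card_of_injOn (fun x => 3 * x) (fun x hx => ?_) fun x hx y hy hxy => ?_
    · exact mem_coe.2 (mem_erase.2 ⟨hx3 x hx, (memK _).2 ⟨x, rfl⟩⟩)
    · simp only at hxy
      have nx := hx3 x hx
      have ny := hx3 y hy
      obtain ⟨hxK, a, ha, ea⟩ := (memS x).1 hx
      obtain ⟨hyK, b, hb, eb⟩ := (memS y).1 hy
      have mx : ∀ c : R, c ∈ quadSteps a ↔ c ∈ quadSteps x := by
        intro c
        rw [mem_quadSteps, mem_quadSteps]
        rcases ea with rfl | rfl
        · rfl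
        · simp only [mul_neg, neg_neg]
          tauto
      have my : ∀ c : R, c ∈ quadSteps b ↔ c ∈ quadSteps y := by
        intro c
        rw [mem_quadSteps, mem_quadSteps]
        rcases eb with rfl | rfl
        · rfl
        · simp only [mul_neg, neg_neg]
          tauto
      have e := hG.eq_of_mem a ha b hb (3 * x) ((mx _).2 (by simp [mem_quadSteps]))
        ((my _).2 (by simp [hxy, mem_quadSteps]))
      have yx : y ∈ quadSteps x := by
        rw [← mx, e, my]
        simp [mem_quadSteps]
      have y2x : 2 * y ∈ quadSteps x := by
        rw [← mx, e, my]
        simp [mem_quadSteps]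
      rcases mem_quadSteps.1 yx with f | f | f | f | f | f
      · exact f.symm
      · exact absurd (h2 (3 * x) (by linear_combination hxy + 3 * f)) nx
      · exact absurd (by linear_combination -hxy - 3 * f) nx
      -- Here `9 * x = 0`, and `2 * y = -4 * x` is not among the differences with step `x`.
      · exfalso
        have h9 : 9 * x = 0 := by linear_combination hxy + 3 * f
        have hx0 : x ≠ 0 := by rintro rfl; exact nx (by simp)
        rcases mem_quadSteps.1 y2x with g | g | g | g | g | g
        · exact hx0 (by linear_combination 4 * f - 2 * g - h9)
        · exact nx (by linear_combination 2 * f - g)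
        · exact nx (h2 (3 * x) (by linear_combination 2 * f - g))
        · exact hx0 (h2 x (by linear_combination 2 * f - g))
        · exact hx0 (h2 x (by linear_combination h9 - 2 * f + g))
        · exact hx0 (by linear_combination 2 * f - g)
      · exact absurd ((memK y).2 ⟨x, f.symm⟩) hyK
      · exact absurd ((memK y).2 ⟨-x, by linear_combination -f⟩) hyK
  have hK3 : K.card * 3 ≤ Fintype.card R := by
    rw [← card_univ, card_eq_sum_card_image (fun z : R => 3 * z) univ, ← smul_eq_mul]
    refine card_nsmul_le_sum _ _ _ fun y hy => ?_
    obtain ⟨z, hz⟩ := (memK y).1 hy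
    have hsub : ({z, z + u, z - u} : Finset R) ⊆ univ.filter fun x => 3 * x = y := by
      intro x hx
      simp only [mem_insert, mem_singleton] at hx
      refine mem_filter.2 ⟨mem_univ _, ?_⟩
      rcases hx with rfl | rfl | rfl
      · exact hz
      · linear_combination hz + h3
      · linear_combination hz - h3
    refine le_trans (le_of_eq (Eq.symm ?_)) (card_le_card hsub)
    refine card_eq_three.2 ⟨z, z + u, z - u, ?_, ?_, ?_, rfl⟩
    · simpa using hu
    · intro h
      exact hu (by linear_combination h)
    · intro h
      exact hu (by linear_combination h3 - h)
  have hK0 : (0 : R) ∈ K := (memK 0).2 ⟨0, by simp⟩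
  have c1 := card_le_card hcover
  have c2 := card_union_le S (S.image fun x => 2 * x)
  have c3 := card_image_le (s := S) (f := fun x => 2 * x)
  have c4 := card_sdiff_add_card_eq_card (subset_univ K)
  have c5 := card_erase_add_one hK0
  rw [card_univ] at c4
  omega

/-- The progression that has the involution `h` as a difference has a step of order four: steps of
order six are excluded by `ht`. -/
lemma exists_order_four (hG : IsStepPartition quadSteps G) (ht : ∀ x : R, 3 * x = 0 → x = 0)
    {h : R} (h0 : h ≠ 0) (h2 : 2 * h = 0) : ∃ c : R, 4 * c = 0 ∧ 2 * c ≠ 0 := by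
  obtain ⟨a, ha, hm⟩ := hG.cover h h0
  have hne := hG.zero_notMem a ha
  simp only [mem_quadSteps, not_or] at hne
  have n2 : 2 * a ≠ 0 := fun e => hne.2.2.1 e.symm
  refine ⟨a, ?_, n2⟩
  rcases mem_quadSteps.1 hm with e | e | e | e | e | e
  · exact absurd (by linear_combination h2 - 2 * e) n2
  · exact absurd (by linear_combination -h2 + 2 * e) n2
  · linear_combination h2 - 2 * e
  · linear_combination -h2 + 2 * e
  · exact absurd (ht _ (by linear_combination h2 - 2 * e)) n2
  · exact absurd (ht _ (by linear_combination -h2 + 2 * e)) n2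

/-- No step `a` has order ten: the differences would contain only one of the pairs `±2a`, `±4a` of
elements of order five, and the other pair could not be covered. -/
lemma ten_mul_ne_zero (hG : IsStepPartition quadSteps G) (ht : ∀ x : R, 3 * x = 0 → x = 0)
    (huniq : ∀ x y : R, x ≠ 0 → y ≠ 0 → 2 * x = 0 → 2 * y = 0 → x = y)
    {a : R} (ha : a ∈ G) (h5 : 5 * a ≠ 0) : 10 * a ≠ 0 := by
  intro h10
  have h0 : a ≠ 0 := by rintro rfl; simp at h5
  have h2 : 2 * a ≠ 0 := fun e => h5 (by
    have := hG.zero_notMem a ha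
    exact absurd (mem_quadSteps.2 (.inr (.inr (.inl e.symm)))) this)
  -- `4 * a` is not a difference of the progression with step `a`.
  have h4 : 4 * a ∉ quadSteps a := by
    intro hm
    rcases mem_quadSteps.1 hm with e | e | e | e | e | e
    · exact h0 (ht a (by linear_combination e))
    · exact h5 (by linear_combination e)
    · exact h2 (by linear_combination e)
    · exact h2 (ht _ (by linear_combination e))
    · exact h0 (by linear_combination e)
    · exact h0 (ht a (by linear_combination h10 - e))
  -- A progression having `2 * a` and `4 * a` as differences would be the one with step `a`.
  have h24 : ∀ b ∈ G, 4 * a ∈ quadSteps b → ∀ c ∈ quadSteps a, c ∉ quadSteps b :=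
    fun b hb h c hc hc' => h4 (hG.eq_of_mem a ha b hb c hc hc' ▸ h)
  have m1 : 2 * a ∈ quadSteps a := by simp [mem_quadSteps]
  have m2 : 3 * a ∈ quadSteps a := by simp [mem_quadSteps]
  obtain ⟨b, hb, hm⟩ := hG.cover (4 * a) (fun e => h2 (by linear_combination 3 * e - h10))
  have hc := h24 b hb hm
  have c2 := hc _ m1
  have c3 := hc _ m2
  rw [mem_quadSteps, not_or, not_or, not_or, not_or, not_or] at c2 c3
  have h5' : 2 * (5 * a) = 0 := by linear_combination h10
  rcases mem_quadSteps.1 hm with e | e | e | e | e | e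
  · exact c2.2.2.2.1 (by linear_combination h10 - 2 * e)
  · exact c2.2.2.1 (by linear_combination h10 - 2 * e)
  · by_cases hz : b - 2 * a = 0
    · exact c2.1 (by linear_combination -hz)
    · have := huniq _ _ hz h5 (by linear_combination -e) h5'
      exact c3.2.1 (by linear_combination h10 + this)
  · by_cases hz : b + 2 * a = 0
    · exact c2.2.1 (by linear_combination hz)
    · have := huniq _ _ hz h5 (by linear_combination e) h5'
      exact c3.1 (by linear_combination -this)
  · have : 5 * b = 0 := ht _ (by linear_combination 2 * h10 - 5 * e)
    exact c2.2.1 (by linear_combination h10 - 2 * e - this)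
  · have : 5 * b = 0 := ht _ (by linear_combination -2 * h10 + 5 * e)
    exact c2.1 (by linear_combination h10 - 2 * e + this)

end IsStepPartition

end Steps

namespace IsStepPartition

variable {R : Type*} [CommRing R] [DecidableEq R] {G : Set R}

lemma sum_tripleWeight (hG : IsStepPartition tripleSteps G) {a : R} (ha : a ∈ G) :
    ∑ δ ∈ tripleSteps a, tripleWeight δ = 12 := by
  have hne := hG.zero_notMem a ha
  simp only [mem_tripleSteps, not_or] at hne
  have n1 : a ≠ 0 := fun e => hne.1 e.symm
  have n2 : 2 * a ≠ 0 := fun e => hne.2.2.1 e.symm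
  by_cases h3 : 3 * a = 0
  · have e : tripleSteps a = {a, -a} := by
      ext δ
      rw [mem_tripleSteps, mem_insert, mem_singleton]
      grind
    rw [e, sum_pair (by grind)]
    have : 3 * -a = 0 := by linear_combination -h3
    have : ¬ 2 * -a = 0 := fun e => n2 (by linear_combination -e)
    simp only [tripleWeight, *]
    norm_num
  have h6 := hG.six_mul_ne_zero ha h3
  by_cases h4 : 4 * a = 0
  · have e : tripleSteps a = {a, -a, 2 * a} := by
      ext δ
      rw [mem_tripleSteps, mem_insert, mem_insert, mem_singleton]
      grind
    rw [e, sum_insert (by grind), sum_pair (by grind)]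
    have : ¬ 3 * -a = 0 := fun e => h3 (by linear_combination -e)
    have : ¬ 2 * -a = 0 := fun e => n2 (by linear_combination -e)
    have : 2 * (2 * a) = 0 := by linear_combination h4
    have : ¬ 3 * (2 * a) = 0 := fun e => h6 (by linear_combination e)
    simp only [tripleWeight, *]
    norm_num
  · rw [tripleSteps, sum_insert (by grind), sum_insert (by grind), sum_pair (by grind)]
    have : ¬ 3 * -a = 0 := fun e => h3 (by linear_combination -e)
    have : ¬ 2 * -a = 0 := fun e => n2 (by linear_combination -e)
    have : ¬ 2 * (2 * a) = 0 := fun e => h4 (by linear_combination e)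
    have : ¬ 3 * (2 * a) = 0 := fun e => h6 (by linear_combination e)
    have : ¬ 2 * -(2 * a) = 0 := fun e => h4 (by linear_combination -e)
    have : ¬ 3 * -(2 * a) = 0 := fun e => h6 (by linear_combination -e)
    simp only [tripleWeight, *]
    norm_num

lemma sum_quadWeight (hG : IsStepPartition quadSteps G) (ht : ∀ x : R, 3 * x = 0 → x = 0)
    (huniq : ∀ x y : R, x ≠ 0 → y ≠ 0 → 2 * x = 0 → 2 * y = 0 → x = y)
    {a : R} (ha : a ∈ G) : ∑ δ ∈ quadSteps a, quadWeight δ = 12 := by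
  have hne := hG.zero_notMem a ha
  simp only [mem_quadSteps, not_or] at hne
  have n1 : a ≠ 0 := fun e => hne.1 e.symm
  have n2 : 2 * a ≠ 0 := fun e => hne.2.2.1 e.symm
  have n3 : 3 * a ≠ 0 := fun e => n1 (ht a e)
  have n6 : 6 * a ≠ 0 := fun e => n2 (ht _ (by linear_combination e))
  have m2 : ¬ 2 * -a = 0 := fun e => n2 (by linear_combination -e)
  by_cases h4 : 4 * a = 0
  · have e : quadSteps a = {a, -a, 2 * a} := by
      ext δ
      rw [mem_quadSteps, mem_insert, mem_insert, mem_singleton]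
      grind
    rw [e, sum_insert (by grind), sum_pair (by grind)]
    have : ¬ 5 * a = 0 := fun e => n1 (by linear_combination e - h4)
    have : ¬ 5 * -a = 0 := fun e => n1 (by linear_combination -e - h4)
    have : 2 * (2 * a) = 0 := by linear_combination h4
    have : ¬ 5 * (2 * a) = 0 := fun e => n2 (by linear_combination e - 2 * h4)
    simp only [quadWeight, *]
    norm_num
  have m4 : ¬ 2 * (2 * a) = 0 := fun e => h4 (by linear_combination e)
  have m4' : ¬ 2 * -(2 * a) = 0 := fun e => h4 (by linear_combination -e)
  by_cases h5 : 5 * a = 0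
  · have e : quadSteps a = {a, -a, 2 * a, -(2 * a)} := by
      ext δ
      rw [mem_quadSteps, mem_insert, mem_insert, mem_insert, mem_singleton]
      grind
    rw [e, sum_insert (by grind), sum_insert (by grind), sum_pair (by grind)]
    have : 5 * -a = 0 := by linear_combination -h5
    have : 5 * (2 * a) = 0 := by linear_combination 2 * h5
    have : 5 * -(2 * a) = 0 := by linear_combination -2 * h5
    simp only [quadWeight, *]
    norm_num
  · have n10 := hG.ten_mul_ne_zero ht huniq ha h5
    have n15 : 15 * a ≠ 0 := fun e => h5 (ht _ (by linear_combination e))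
    rw [quadSteps, sum_insert (by grind), sum_insert (by grind), sum_insert (by grind),
      sum_insert (by grind), sum_pair (by grind)]
    have : ¬ 5 * -a = 0 := fun e => h5 (by linear_combination -e)
    have : ¬ 5 * (2 * a) = 0 := fun e => n10 (by linear_combination e)
    have : ¬ 5 * -(2 * a) = 0 := fun e => n10 (by linear_combination -e)
    have : ¬ 5 * (3 * a) = 0 := fun e => n15 (by linear_combination e)
    have : ¬ 5 * -(3 * a) = 0 := fun e => n15 (by linear_combination -e)
    have : ¬ 2 * (3 * a) = 0 := fun e => n6 (by linear_combination e)
    have : ¬ 2 * -(3 * a) = 0 := fun e => n6 (by linear_combination -e)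
    simp only [quadWeight, *]
    norm_num

end IsStepPartition

/-! ### Elements of small order -/

lemma card_filter_prime_mul_eq_zero {L p : ℕ} [NeZero L] (hp : p.Prime) :
    ((univ.erase (0 : ZMod L)).filter fun δ => (p : ZMod L) * δ = 0).card =
      if p ∣ L then p - 1 else 0 := by
  have e : ((univ.erase (0 : ZMod L)).filter fun δ => (p : ZMod L) * δ = 0) =
      univ.filter fun δ => addOrderOf δ = p := by
    ext δ
    simp only [mem_filter, mem_erase, mem_univ, and_true, true_and, ← nsmul_eq_mul]
    constructor
    · rintro ⟨h0, h⟩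
      exact ((hp.eq_one_or_self_of_dvd _ (addOrderOf_dvd_of_nsmul_eq_zero h)).resolve_left
        fun h1 => h0 (AddMonoid.addOrderOf_eq_one_iff.1 h1))
    · intro h
      refine ⟨?_, h ▸ addOrderOf_nsmul_eq_zero δ⟩
      rintro rfl
      rw [addOrderOf_zero] at h
      exact hp.one_lt.ne h
  rw [e]
  split_ifs with h
  · rw [IsAddCyclic.card_addOrderOf_eq_totient (by rwa [ZMod.card]), Nat.totient_prime hp]
  · refine card_eq_zero.2 (filter_eq_empty_iff.2 fun δ _ hδ => h ?_)
    rw [← hδ]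
    simpa only [ZMod.card] using addOrderOf_dvd_card (x := δ)

lemma sum_ite_prime_mul_eq_zero {L p : ℕ} [NeZero L] (hp : p.Prime) (c : ℕ) :
    ∑ δ ∈ univ.erase (0 : ZMod L), (if (p : ZMod L) * δ = 0 then c else 0) =
      if p ∣ L then (p - 1) * c else 0 := by
  rw [← sum_filter, sum_const, card_filter_prime_mul_eq_zero hp, smul_eq_mul]
  split_ifs <;> simp

lemma exists_prime_mul_eq_zero_iff {L p : ℕ} [NeZero L] (hp : p.Prime) :
    (∃ δ : ZMod L, δ ≠ 0 ∧ (p : ZMod L) * δ = 0) ↔ p ∣ L := by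
  have h := card_filter_prime_mul_eq_zero (L := L) hp
  have h2 := hp.two_le
  constructor
  · rintro ⟨δ, h0, hδ⟩
    by_contra hL
    rw [if_neg hL, card_eq_zero] at h
    exact notMem_empty δ (h ▸ by simp [h0, hδ])
  · intro hL
    rw [if_pos hL] at h
    obtain ⟨δ, hδ⟩ := card_pos.1 (by omega : 0 <
      ((univ.erase (0 : ZMod L)).filter fun δ => (p : ZMod L) * δ = 0).card)
    simp only [mem_filter, mem_erase, mem_univ, and_true] at hδ
    exact ⟨δ, hδ⟩

lemma eq_of_two_mul_eq_zero {L : ℕ} [NeZero L] (x y : ZMod L) (hx : x ≠ 0) (hy : y ≠ 0)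
    (hx2 : 2 * x = 0) (hy2 : 2 * y = 0) : x = y := by
  have h := card_filter_prime_mul_eq_zero (L := L) Nat.prime_two
  refine card_le_one.1 (h.trans_le (by split_ifs <;> simp)) x ?_ y ?_
  · simp [hx, hx2]
  · simp [hy, hy2]

lemma four_dvd_of_order_four {L : ℕ} [NeZero L] {c : ZMod L} (h4 : 4 * c = 0) (h2 : 2 * c ≠ 0) :
    4 ∣ L := by
  have h : addOrderOf c = 2 ^ (1 + 1) := by
    refine addOrderOf_eq_prime_pow ?_ ?_
    · simpa [nsmul_eq_mul] using h2
    · rw [nsmul_eq_mul]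
      push_cast
      linear_combination h4
  have := addOrderOf_dvd_card (x := c)
  rwa [h, ZMod.card] at this

lemma sum_tripleWeight_univ {L : ℕ} [NeZero L] :
    ∑ δ ∈ univ.erase (0 : ZMod L), tripleWeight δ =
      3 * (L - 1) + (if 2 ∣ L then 3 else 0) + (if 3 ∣ L then 6 else 0) := by
  have h2 := sum_ite_prime_mul_eq_zero (L := L) Nat.prime_two 3
  have h3 := sum_ite_prime_mul_eq_zero (L := L) Nat.prime_three 3
  push_cast at h2 h3
  simp only [tripleWeight, sum_add_distrib, h2, h3, sum_const, card_erase_of_mem (mem_univ _),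
    card_univ, ZMod.card, smul_eq_mul]
  ring

lemma sum_quadWeight_univ {L : ℕ} [NeZero L] :
    ∑ δ ∈ univ.erase (0 : ZMod L), quadWeight δ =
      2 * (L - 1) + (if 2 ∣ L then 6 else 0) + (if 5 ∣ L then 4 else 0) := by
  have h2 := sum_ite_prime_mul_eq_zero (L := L) Nat.prime_two 6
  have h5 := sum_ite_prime_mul_eq_zero (L := L) Nat.prime_five 1
  push_cast at h2 h5
  simp only [quadWeight, sum_add_distrib, h2, h5, sum_const, card_erase_of_mem (mem_univ _),
    card_univ, ZMod.card, smul_eq_mul]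
  ring

/-! ### Length six -/

/-- Weight of a difference inside a channel for `w = 4` and `L = 6`; differences between channels
weigh `2`, and every codeword weighs at least `24`. The total weight `26` of a channel exceeds this
bound slightly. -/
def sixWeight (δ : ZMod 6) : ℕ :=
  if 2 * δ = 0 then 8 else if 3 * δ = 0 then 6 else 3

lemma le_sum_sixWeight : ∀ A : Finset (ZMod 6), A.Nonempty → A.card ≤ 4 →
    24 ≤ ∑ δ ∈ innerDiffs A, sixWeight δ + 2 * ((4 - A.card) * (4 + A.card - 1)) := by
  decide +kernel

lemma le_sum_sixWeight_add : ∀ A B : Finset (ZMod 6), A.card = 2 → B.card = 2 →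
    24 ≤ ∑ δ ∈ innerDiffs A, sixWeight δ + ∑ δ ∈ innerDiffs B, sixWeight δ +
      2 * ((A - B).card + (B - A).card) := by
  decide +kernel

/-! ### Differences of an equi-difference code -/

lemma innerDiffs_progression_three {R : Type*} [CommRing R] [DecidableEq R] {s a : R}
    (h : ((range 3).image fun k : ℕ => s + (k : R) * a).card = 3) :
    innerDiffs ((range 3).image fun k : ℕ => s + (k : R) * a) = tripleSteps a := by
  have hinj : Set.InjOn (fun k : ℕ => s + (k : R) * a) (range 3) :=
    card_image_iff.1 (by simpa using h)
  have hmem : ∀ k : ℕ, k < 3 → s + (k : R) * a ∈ (range 3).image fun k : ℕ => s + (k : R) * a :=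
    fun k hk => mem_image_of_mem _ (mem_range.2 hk)
  have hd : ∀ k : ℕ, k < 3 → ∀ l : ℕ, l < 3 → k ≠ l → (s + (k : R) * a) - (s + (l : R) * a) ∈
      innerDiffs ((range 3).image fun k : ℕ => s + (k : R) * a) := fun k hk l hl hkl =>
    sub_mem_innerDiffs (hmem k hk) (hmem l hl)
      fun e => hkl (hinj (by simpa using hk) (by simpa using hl) e)
  ext δ
  rw [mem_tripleSteps]
  constructor
  · intro hδ
    obtain ⟨x, hx, y, hy, hne, rfl⟩ := mem_innerDiffs.1 hδ
    obtain ⟨k, hk, rfl⟩ := mem_image.1 hx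
    obtain ⟨l, hl, rfl⟩ := mem_image.1 hy
    rw [mem_range] at hk hl
    interval_cases k <;> interval_cases l <;> push_cast at hne ⊢ <;> grind
  · rintro (rfl | rfl | rfl | rfl)
    · convert hd 1 (by norm_num) 0 (by norm_num) (by norm_num) using 1; push_cast; ring
    · convert hd 0 (by norm_num) 1 (by norm_num) (by norm_num) using 1; push_cast; ring
    · convert hd 2 (by norm_num) 0 (by norm_num) (by norm_num) using 1; push_cast; ring
    · convert hd 0 (by norm_num) 2 (by norm_num) (by norm_num) using 1; push_cast; ring

lemma innerDiffs_progression_four {R : Type*} [CommRing R] [DecidableEq R] {s a : R}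
    (h : ((range 4).image fun k : ℕ => s + (k : R) * a).card = 4) :
    innerDiffs ((range 4).image fun k : ℕ => s + (k : R) * a) = quadSteps a := by
  have hinj : Set.InjOn (fun k : ℕ => s + (k : R) * a) (range 4) :=
    card_image_iff.1 (by simpa using h)
  have hmem : ∀ k : ℕ, k < 4 → s + (k : R) * a ∈ (range 4).image fun k : ℕ => s + (k : R) * a :=
    fun k hk => mem_image_of_mem _ (mem_range.2 hk)
  have hd : ∀ k : ℕ, k < 4 → ∀ l : ℕ, l < 4 → k ≠ l → (s + (k : R) * a) - (s + (l : R) * a) ∈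
      innerDiffs ((range 4).image fun k : ℕ => s + (k : R) * a) := fun k hk l hl hkl =>
    sub_mem_innerDiffs (hmem k hk) (hmem l hl)
      fun e => hkl (hinj (by simpa using hk) (by simpa using hl) e)
  ext δ
  rw [mem_quadSteps]
  constructor
  · intro hδ
    obtain ⟨x, hx, y, hy, hne, rfl⟩ := mem_innerDiffs.1 hδ
    obtain ⟨k, hk, rfl⟩ := mem_image.1 hx
    obtain ⟨l, hl, rfl⟩ := mem_image.1 hy
    rw [mem_range] at hk hl
    interval_cases k <;> interval_cases l <;> push_cast at hne ⊢ <;> grind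
  · rintro (rfl | rfl | rfl | rfl | rfl | rfl)
    · convert hd 1 (by norm_num) 0 (by norm_num) (by norm_num) using 1; push_cast; ring
    · convert hd 0 (by norm_num) 1 (by norm_num) (by norm_num) using 1; push_cast; ring
    · convert hd 2 (by norm_num) 0 (by norm_num) (by norm_num) using 1; push_cast; ring
    · convert hd 0 (by norm_num) 2 (by norm_num) (by norm_num) using 1; push_cast; ring
    · convert hd 3 (by norm_num) 0 (by norm_num) (by norm_num) using 1; push_cast; ring
    · convert hd 0 (by norm_num) 3 (by norm_num) (by norm_num) using 1; push_cast; ring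

lemma mem_onChannel {M L : ℕ} {i j : Fin M} {x : ZMod L} {T : Finset (ZMod L)} :
    (j, x) ∈ onChannel i T ↔ j = i ∧ x ∈ T := by
  simp [onChannel, eq_comm, and_comm]

lemma onChannel_injective {M L : ℕ} (i : Fin M) :
    Function.Injective (onChannel (L := L) i) := by
  intro T T' h
  ext x
  have := Finset.ext_iff.1 h (i, x)
  simpa [mem_onChannel] using this

section CAC

variable {L w : ℕ} {C₀ : Finset (Finset (ZMod L))}

lemma IsCAC.card_eq (h : IsCAC L w C₀) {T : Finset (ZMod L)} (hT : T ∈ C₀) : T.card = w := by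
  have := h.1 _ (mem_image_of_mem _ hT)
  simpa [onChannel] using this

lemma IsCAC.eq_of_sub_eq (h : IsCAC L w C₀) {T T' : Finset (ZMod L)} (hT : T ∈ C₀)
    (hT' : T' ∈ C₀) {x y x' y' : ZMod L} (hx : x ∈ T) (hy : y ∈ T) (hne : x ≠ y)
    (hx' : x' ∈ T') (hy' : y' ∈ T') (he : x - y = x' - y') : T = T' :=
  onChannel_injective 0 (IsMCCAC.eq_of_sub_eq h (mem_image_of_mem _ hT) (mem_image_of_mem _ hT')
    (mem_onChannel.2 ⟨rfl, hx⟩) (mem_onChannel.2 ⟨rfl, hy⟩) (by simpa using hne)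
    (mem_onChannel.2 ⟨rfl, hx'⟩) (mem_onChannel.2 ⟨rfl, hy'⟩) he)

lemma IsCAC.eq_of_mem_innerDiffs (h : IsCAC L w C₀) {T T' : Finset (ZMod L)} (hT : T ∈ C₀)
    (hT' : T' ∈ C₀) {δ : ZMod L} (hδ : δ ∈ innerDiffs T) (hδ' : δ ∈ innerDiffs T') : T = T' := by
  obtain ⟨x, hx, y, hy, hne, e⟩ := mem_innerDiffs.1 hδ
  obtain ⟨x', hx', y', hy', -, e'⟩ := mem_innerDiffs.1 hδ'
  exact h.eq_of_sub_eq hT hT' hx hy hne hx' hy' (e.trans e'.symm)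

lemma IsTight.exists_mem_innerDiffs (h : IsTight L C₀) {δ : ZMod L} (hδ : δ ≠ 0) :
    ∃ T ∈ C₀, δ ∈ innerDiffs T := by
  obtain ⟨T, hT, x, hx, y, hy, rfl⟩ := h δ hδ
  exact ⟨T, hT, sub_mem_innerDiffs hx hy fun e => hδ (sub_eq_zero.2 e)⟩

/-- The steps of the codewords of a tight equi-difference code form a step partition. -/
lemma isStepPartition_of_tight {P : ZMod L → Finset (ZMod L)}
    (hP : ∀ s a : ZMod L, ((range w).image fun k : ℕ => s + (k : ZMod L) * a).card = w →
      innerDiffs ((range w).image fun k : ℕ => s + (k : ZMod L) * a) = P a)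
    (hCAC : IsCAC L w C₀) (hequi : IsEquiDifference L w C₀) (htight : IsTight L C₀) :
    IsStepPartition P
      {a | ∃ s : ZMod L, ((range w).image fun k : ℕ => s + (k : ZMod L) * a) ∈ C₀} where
  zero_notMem := by
    rintro a ⟨s, hs⟩
    rw [← hP s a (hCAC.card_eq hs)]
    exact zero_notMem_innerDiffs _
  cover := by
    intro δ hδ
    obtain ⟨T, hT, hδT⟩ := htight.exists_mem_innerDiffs hδ
    obtain ⟨s, a, rfl⟩ := hequi T hT
    exact ⟨a, ⟨s, hT⟩, by rwa [← hP s a (hCAC.card_eq hT)]⟩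
  eq_of_mem := by
    rintro a ⟨s, hs⟩ b ⟨t, ht⟩ δ ha hb
    rw [← hP s a (hCAC.card_eq hs)] at ha ⊢
    rw [← hP t b (hCAC.card_eq ht)] at hb ⊢
    rw [hCAC.eq_of_mem_innerDiffs hs ht ha hb]

/-- The difference sets of the codewords of a tight code partition the nonzero elements. -/
lemma card_mul_eq_sum_of_tight [NeZero L] (hCAC : IsCAC L w C₀) (htight : IsTight L C₀)
    (β : ZMod L → ℕ) (N : ℕ) (hβ : ∀ T ∈ C₀, ∑ δ ∈ innerDiffs T, β δ = N) :
    C₀.card * N = ∑ δ ∈ univ.erase 0, β δ := by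
  have e : univ.erase (0 : ZMod L) = C₀.biUnion innerDiffs := by
    ext δ
    simp only [mem_erase, mem_univ, and_true, mem_biUnion]
    refine ⟨htight.exists_mem_innerDiffs, ?_⟩
    rintro ⟨T, -, hδ⟩ rfl
    exact zero_notMem_innerDiffs T hδ
  rw [e, sum_biUnion, sum_congr rfl hβ, sum_const, smul_eq_mul]
  exact fun T hT T' hT' hne =>
    disjoint_left.2 fun δ hδ hδ' => hne (hCAC.eq_of_mem_innerDiffs hT hT' hδ hδ')

end CAC

/-! ### The combined code -/

section Combined

variable {M L w b : ℕ} [NeZero L] {X : Fin M → Fin b → Option (ZMod L)}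
  {C₀ : Finset (Finset (ZMod L))}

lemma mem_columnPattern {j : Fin b} {i : Fin M} {x : ZMod L} :
    (i, x) ∈ columnPattern X j ↔ X i j = some x := by
  simp [columnPattern]

lemma card_columnPattern (hX : IsGBRD M L w b X) (j : Fin b) :
    (columnPattern X j).card = w := by
  rw [← hX.2.1 j]
  refine card_bij (fun p _ => p.1) ?_ ?_ ?_
  · rintro ⟨i, x⟩ h
    rw [mem_columnPattern] at h
    simp [h]
  · rintro ⟨i, x⟩ h ⟨i', x'⟩ h' rfl
    rw [mem_columnPattern] at h h'
    simpa [h] using h'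
  · intro i hi
    obtain ⟨x, hx⟩ := Option.isSome_iff_exists.1 (mem_filter.1 hi).2
    exact ⟨(i, x), mem_columnPattern.2 hx, rfl⟩

lemma channel_ne_of_mem_columnPattern {j : Fin b} {i i' : Fin M} {x x' : ZMod L}
    (h : (i, x) ∈ columnPattern X j) (h' : (i', x') ∈ columnPattern X j)
    (hne : (i, x) ≠ (i', x')) : i ≠ i' := by
  rintro rfl
  rw [mem_columnPattern] at h h'
  exact hne (by simpa [h] using h')

/-- Two columns of a GBRD have no difference in common. -/
lemma IsGBRD.column_eq (hX : IsGBRD M L w b X) {j j' : Fin b} {i i' : Fin M} {x y x' y' : ZMod L}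
    (hx : (i, x) ∈ columnPattern X j) (hy : (i', y) ∈ columnPattern X j)
    (hne : (i, x) ≠ (i', y)) (hx' : (i, x') ∈ columnPattern X j')
    (hy' : (i', y') ∈ columnPattern X j') (h : x - y = x' - y') : j = j' := by
  have hi := channel_ne_of_mem_columnPattern hx hy hne
  rw [mem_columnPattern] at hx hy hx' hy'
  exact (hX.2.2 i i' hi (x - y)).unique ⟨x, y, hx, hy, rfl⟩ ⟨x', y', hx', hy', h.symm⟩

lemma mem_combinedCode {S : Finset (Fin M × ZMod L)} : S ∈ combinedCode X C₀ ↔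
    (∃ j, columnPattern X j = S) ∨ ∃ i, ∃ T ∈ C₀, onChannel i T = S := by
  simp [combinedCode]

lemma isMCCAC_combinedCode (hCAC : IsCAC L w C₀) (hX : IsGBRD M L w b X) :
    IsMCCAC M L w (combinedCode X C₀) := by
  constructor
  · intro S hS
    rcases mem_combinedCode.1 hS with ⟨j, rfl⟩ | ⟨i, T, hT, rfl⟩
    · exact card_columnPattern hX j
    · simpa [onChannel] using hCAC.card_eq hT
  · intro S hS S' hS' hne τ
    by_contra hτ
    obtain ⟨⟨i, x⟩, hp, ⟨i', y⟩, hq, hpq⟩ := one_lt_card.1 (not_le.1 hτ)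
    obtain ⟨hx, hx'⟩ := mem_filter.1 hp
    obtain ⟨hy, hy'⟩ := mem_filter.1 hq
    have hpq' : (i, x + τ) ≠ (i', y + τ) := by simpa using hpq
    have hxy : x - y = (x + τ) - (y + τ) := by ring
    refine hne ?_
    rcases mem_combinedCode.1 hS with ⟨j, rfl⟩ | ⟨k, T, hT, rfl⟩ <;>
      rcases mem_combinedCode.1 hS' with ⟨j', rfl⟩ | ⟨k', T', hT', rfl⟩
    · rw [hX.column_eq hx hy hpq hx' hy' hxy]
    · refine absurd ?_ (channel_ne_of_mem_columnPattern hx hy hpq)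
      exact (mem_onChannel.1 hx').1.trans (mem_onChannel.1 hy').1.symm
    · refine absurd ?_ (channel_ne_of_mem_columnPattern hx' hy' hpq')
      exact (mem_onChannel.1 hx).1.trans (mem_onChannel.1 hy).1.symm
    · obtain ⟨e, hxT⟩ := mem_onChannel.1 hx
      obtain ⟨-, hyT⟩ := mem_onChannel.1 hy
      obtain ⟨e', hxT'⟩ := mem_onChannel.1 hx'
      obtain ⟨e'', hyT'⟩ := mem_onChannel.1 hy'
      have hne' : x ≠ y := fun h => hpq (Prod.ext (e'.trans e''.symm) h)
      rw [hCAC.eq_of_sub_eq hT hT' hxT hyT hne' hxT' hyT' hxy, ← e, ← e']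

lemma card_combinedCode (hw : 2 ≤ w) (hCAC : IsCAC L w C₀) (hX : IsGBRD M L w b X) :
    (combinedCode X C₀).card = b + M * C₀.card := by
  have two_ones : ∀ j : Fin b, ∃ p ∈ columnPattern X j, ∃ q ∈ columnPattern X j, p ≠ q :=
    fun j => one_lt_card.1 (by rw [card_columnPattern hX j]; omega)
  rw [combinedCode, card_union_of_disjoint, card_image_of_injective, card_biUnion]
  · simp only [card_image_of_injective _ (onChannel_injective _)]
    simp
  · intro i _ i' _ hne
    refine disjoint_left.2 fun S hS hS' => hne ?_
    obtain ⟨T, hT, rfl⟩ := mem_image.1 hS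
    obtain ⟨T', -, h⟩ := mem_image.1 hS'
    obtain ⟨x, hx⟩ := card_pos.1 (by rw [hCAC.card_eq hT]; omega : 0 < T.card)
    have : (i, x) ∈ onChannel i' T' := h ▸ mem_onChannel.2 ⟨rfl, hx⟩
    exact (mem_onChannel.1 this).1
  · intro j j' h
    obtain ⟨⟨i, x⟩, hx, ⟨i', y⟩, hy, hne⟩ := two_ones j
    exact hX.column_eq hx hy hne (h ▸ hx) (h ▸ hy) rfl
  · refine disjoint_left.2 fun S hS hS' => ?_
    obtain ⟨j, -, rfl⟩ := mem_image.1 hS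
    obtain ⟨k, -, h⟩ := mem_biUnion.1 hS'
    obtain ⟨T, -, h⟩ := mem_image.1 h
    obtain ⟨⟨i, x⟩, hx, ⟨i', y⟩, hy, hne⟩ := two_ones j
    refine channel_ne_of_mem_columnPattern hx hy hne ?_
    rw [← h] at hx hy
    exact (mem_onChannel.1 hx).1.trans (mem_onChannel.1 hy).1.symm

lemma isOptimalMCCAC_combinedCode (hw : 2 ≤ w) (hCAC : IsCAC L w C₀) (hX : IsGBRD M L w b X)
    (h : ∀ C' : Finset (Finset (Fin M × ZMod L)), IsMCCAC M L w C' →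
      C'.card ≤ b + M * C₀.card) : IsOptimalMCCAC M L w (combinedCode X C₀) := by
  refine ⟨isMCCAC_combinedCode hCAC hX, ⟨_, isMCCAC_combinedCode hCAC hX, rfl⟩, ?_⟩
  rintro n ⟨C', hC', rfl⟩
  rw [card_combinedCode hw hCAC hX]
  exact h C' hC'

end Combined

/-! ### Sizes -/

section Sizes

variable {M L b : ℕ} [NeZero L] {X : Fin M → Fin b → Option (ZMod L)}
  {C₀ : Finset (Finset (ZMod L))}

lemma card_mul_le_of_isMCCAC_three {C : Finset (Finset (Fin M × ZMod L))} (hC : IsMCCAC M L 3 C) :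
    C.card * 12 ≤ M * ∑ δ ∈ univ.erase (0 : ZMod L), tripleWeight δ + 2 * (M * (M - 1) * L) := by
  refine hC.card_mul_le 2 12 tripleWeight fun S hS => ?_
  refine le_weight_of_profile (by norm_num) (by norm_num) 2 12 tripleWeight ?_
    (by norm_num) S (hC.1 S hS)
  intro A hA hA3
  have hA0 := card_pos.2 hA
  obtain h | h | h : A.card = 1 ∨ A.card = 2 ∨ A.card = 3 := by omega
  · rw [h]; omega
  · have := four_le_sum_tripleWeight h
    rw [h]; omega
  · have := twelve_le_sum_tripleWeight h
    rw [h]; omega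

lemma card_mul_le_of_isMCCAC_four (ht : ∀ x : ZMod L, 3 * x = 0 → x = 0)
    {C : Finset (Finset (Fin M × ZMod L))} (hC : IsMCCAC M L 4 C) :
    C.card * 12 ≤ M * ∑ δ ∈ univ.erase (0 : ZMod L), quadWeight δ + 1 * (M * (M - 1) * L) := by
  refine hC.card_mul_le 1 12 quadWeight fun S hS => ?_
  refine le_weight_of_profile (by norm_num) (by norm_num) 1 12 quadWeight ?_ ?_ S (hC.1 S hS)
  · intro A hA hA4
    have hA0 := card_pos.2 hA
    obtain h | h | h | h : A.card = 1 ∨ A.card = 2 ∨ A.card = 3 ∨ A.card = 4 := by omega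
    · rw [h]; omega
    · have := four_le_sum_quadWeight h
      rw [h]; omega
    · have := six_le_sum_quadWeight ht h
      rw [h]; omega
    · have := twelve_le_sum_quadWeight ht h
      rw [h]; omega
  · intro _ A B hA hB
    have e1 := four_le_sum_quadWeight hA
    have e2 := four_le_sum_quadWeight hB
    have e3 := card_le_card_sub_right (s := A) (t := B) (card_pos.1 (by omega))
    have e4 := card_le_card_sub_right (s := B) (t := A) (card_pos.1 (by omega))
    omega

lemma card_mul_le_of_isMCCAC_six {C : Finset (Finset (Fin M × ZMod 6))} (hC : IsMCCAC M 6 4 C) :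
    C.card * 24 ≤ M * 26 + 2 * (M * (M - 1) * 6) := by
  have h26 : ∑ δ ∈ univ.erase (0 : ZMod 6), sixWeight δ = 26 := by decide +kernel
  rw [← h26]
  refine hC.card_mul_le 2 24 sixWeight fun S hS => ?_
  exact le_weight_of_profile (by norm_num) (by norm_num) 2 24 sixWeight le_sum_sixWeight
    (fun _ => le_sum_sixWeight_add) S (hC.1 S hS)

lemma card_mul_of_tight_three (hCAC : IsCAC L 3 C₀) (hequi : IsEquiDifference L 3 C₀)
    (htight : IsTight L C₀) :
    C₀.card * 12 = ∑ δ ∈ univ.erase (0 : ZMod L), tripleWeight δ := by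
  refine card_mul_eq_sum_of_tight hCAC htight _ _ fun T hT => ?_
  obtain ⟨s, a, rfl⟩ := hequi T hT
  rw [innerDiffs_progression_three (hCAC.card_eq hT)]
  exact (isStepPartition_of_tight (fun _ _ => innerDiffs_progression_three)
    hCAC hequi htight).sum_tripleWeight ⟨s, hT⟩

/-- For codewords of length four, tightness forces `L = 6` or `L` coprime to three. -/
lemma eq_zero_of_three_mul_of_tight (hL : L ≠ 6) (hCAC : IsCAC L 4 C₀)
    (hequi : IsEquiDifference L 4 C₀) (htight : IsTight L C₀) (x : ZMod L) (hx : 3 * x = 0) :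
    x = 0 := by
  have hG := isStepPartition_of_tight (fun _ _ => innerDiffs_progression_four) hCAC hequi htight
  by_cases h2 : ∀ x : ZMod L, 2 * x = 0 → x = 0
  · exact hG.eq_zero_of_three_mul h2 hx
  push Not at h2
  obtain ⟨h, h2, h0⟩ := h2
  by_contra hx0
  have h6 := hG.six_eq_zero h0 h2 hx0 hx
  have d6 : L ∣ 6 := (ZMod.natCast_eq_zero_iff 6 L).1 (by exact_mod_cast h6)
  have d2 : 2 ∣ L := (exists_prime_mul_eq_zero_iff Nat.prime_two).1 ⟨h, h0, by exact_mod_cast h2⟩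
  have d3 : 3 ∣ L := (exists_prime_mul_eq_zero_iff Nat.prime_three).1 ⟨x, hx0, by exact_mod_cast hx⟩
  exact hL (Nat.dvd_antisymm d6 (Nat.Coprime.mul_dvd_of_dvd_of_dvd (by norm_num) d2 d3))

lemma card_mul_of_tight_four (hL : L ≠ 6) (hCAC : IsCAC L 4 C₀)
    (hequi : IsEquiDifference L 4 C₀) (htight : IsTight L C₀) :
    C₀.card * 12 = ∑ δ ∈ univ.erase (0 : ZMod L), quadWeight δ := by
  refine card_mul_eq_sum_of_tight hCAC htight _ _ fun T hT => ?_
  obtain ⟨s, a, rfl⟩ := hequi T hT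
  rw [innerDiffs_progression_four (hCAC.card_eq hT)]
  exact (isStepPartition_of_tight (fun _ _ => innerDiffs_progression_four)
    hCAC hequi htight).sum_quadWeight (eq_zero_of_three_mul_of_tight hL hCAC hequi htight)
    eq_of_two_mul_eq_zero ⟨s, hT⟩

lemma sizeBound3_eq (hM : 1 ≤ M) (hb : b * 6 = L * (M * (M - 1))) {n : ℕ}
    (hn : n * 12 = 3 * (L - 1) + (if 2 ∣ L then 3 else 0) + (if 3 ∣ L then 6 else 0)) :
    ((b + M * n : ℕ) : ℤ) = sizeBound3 M L := by
  have hL : 1 ≤ L := Nat.one_le_iff_ne_zero.2 (NeZero.ne L)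
  rw [sizeBound3]
  have hb' : (b : ℚ) * 6 = L * (M * (M - 1)) := by
    have := congrArg (Nat.cast : ℕ → ℚ) hb
    push_cast [Nat.cast_sub hM] at this
    exact this
  have hn' : (n : ℚ) * 12 = 3 * (L - 1) + (if 2 ∣ L then 3 else 0) + (if 3 ∣ L then 6 else 0) := by
    have := congrArg (Nat.cast : ℕ → ℚ) hn
    push_cast [Nat.cast_sub hL] at this
    exact this
  have e : (M : ℚ) / 12 * (2 * M * L + L - 3 + (if 2 ∣ L then 3 else 0) +
      (if 3 ∣ L then 6 else 0)) = ((b + M * n : ℕ) : ℚ) := by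
    push_cast
    linear_combination -hb' / 6 - M / 12 * hn'
  rw [e, Int.floor_natCast]

lemma sizeBound4_eq (hM : 1 ≤ M) (hb : b * 12 = L * (M * (M - 1))) (h3 : ¬ 3 ∣ L)
    (h4 : 2 ∣ L → 4 ∣ L) {n : ℕ}
    (hn : n * 12 = 2 * (L - 1) + (if 2 ∣ L then 6 else 0) + (if 5 ∣ L then 4 else 0)) :
    ((b + M * n : ℕ) : ℤ) = sizeBound4 M L := by
  have hL : 1 ≤ L := Nat.one_le_iff_ne_zero.2 (NeZero.ne L)
  have h42 : 4 ∣ L ↔ 2 ∣ L := ⟨fun h => (by norm_num : 2 ∣ 4).trans h, h4⟩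
  rw [sizeBound4]
  have hb' : (b : ℚ) * 12 = L * (M * (M - 1)) := by
    have := congrArg (Nat.cast : ℕ → ℚ) hb
    push_cast [Nat.cast_sub hM] at this
    exact this
  have hn' : (n : ℚ) * 12 = 2 * (L - 1) + (if 2 ∣ L then 6 else 0) + (if 5 ∣ L then 4 else 0) := by
    have := congrArg (Nat.cast : ℕ → ℚ) hn
    push_cast [Nat.cast_sub hL] at this
    exact this
  have e : (M : ℚ) / 12 * (M * L + L - 2 + 2 * ((if 2 ∣ L then 1 else 0) +
      (if 3 ∣ L then 2 else 0) + (if 4 ∣ L then 2 else 0) + (if 5 ∣ L then 2 else 0))) =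
      ((b + M * n : ℕ) : ℚ) := by
    simp only [h42, h3, if_false]
    push_cast
    split_ifs at hn' ⊢ <;> linear_combination -hb' / 12 - M / 12 * hn'
  rw [e, Int.floor_natCast]

end Sizes

theorem theorem4 (M L w b : ℕ) [NeZero L] (hw : w = 3 ∨ w = 4) (hwM : w ≤ M) (hML : M ≤ L)
    (C₀ : Finset (Finset (ZMod L))) (hCAC : IsCAC L w C₀)
    (hequi : IsEquiDifference L w C₀) (htight : IsTight L C₀)
    (X : Fin M → Fin b → Option (ZMod L)) (hX : IsGBRD M L w b X) :
    IsOptimalMCCAC M L w (combinedCode X C₀) ∧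
      (w = 3 → ((combinedCode X C₀).card : ℤ) = sizeBound3 M L) ∧
      (w = 4 → L ≠ 6 → ((combinedCode X C₀).card : ℤ) = sizeBound4 M L) := by
  have hb := hX.1
  have hM : 1 ≤ M := by omega
  rw [card_combinedCode (by omega) hCAC hX]
  rcases hw with rfl | rfl
  · have h0 := card_mul_of_tight_three hCAC hequi htight
    refine ⟨isOptimalMCCAC_combinedCode (by norm_num) hCAC hX fun C' hC' => ?_, fun _ => ?_,
      by norm_num⟩
    · have h := card_mul_le_of_isMCCAC_three hC'
      rw [← h0] at h
      nlinarith
    · exact sizeBound3_eq hM hb (h0.trans sum_tripleWeight_univ)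
  · by_cases hL : L = 6
    · subst hL
      refine ⟨isOptimalMCCAC_combinedCode (by norm_num) hCAC hX fun C' hC' => ?_, by norm_num,
        fun _ h => absurd rfl h⟩
      have h := card_mul_le_of_isMCCAC_six hC'
      obtain ⟨T, hT, -⟩ := htight.exists_mem_innerDiffs (δ := 1) (by decide)
      have h1 : M * 1 ≤ M * C₀.card := Nat.mul_le_mul_left M (card_pos.2 ⟨T, hT⟩)
      have hb' : b * 12 = M * (M - 1) * 6 := by linarith
      rw [← hb'] at h
      -- The excess `2 * M ≤ 12` of the total weight is less than the weight of a codeword.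
      omega
    · have h0 := card_mul_of_tight_four hL hCAC hequi htight
      have ht := eq_zero_of_three_mul_of_tight hL hCAC hequi htight
      refine ⟨isOptimalMCCAC_combinedCode (by norm_num) hCAC hX fun C' hC' => ?_, by norm_num,
        fun _ _ => ?_⟩
      · have h := card_mul_le_of_isMCCAC_four ht hC'
        rw [← h0] at h
        nlinarith
      · refine sizeBound4_eq hM hb (fun h3 => ?_) (fun h2 => ?_) (h0.trans sum_quadWeight_univ)
        · obtain ⟨u, hu, hu3⟩ := (exists_prime_mul_eq_zero_iff Nat.prime_three).2 h3
          exact hu (ht u (by exact_mod_cast hu3))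
        · obtain ⟨h, h0, h2⟩ := (exists_prime_mul_eq_zero_iff Nat.prime_two).2 h2
          obtain ⟨c, hc4, hc2⟩ := (isStepPartition_of_tight
            (fun _ _ => innerDiffs_progression_four) hCAC hequi htight).exists_order_four ht h0
            (by exact_mod_cast h2)
          exact four_dvd_of_order_four hc4 hc2
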